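/- Let $\log$ denote the natural logarithm. For $\varepsilon_1>0$, $k>0$ put $\varepsilon(x,\varepsilon_1,k)=0$ if $x<k/5$ and $\varepsilon(x,\varepsilon_1,k)=\varepsilon_1/\log^2(15x/k)$ if $x\ge k/5$. For a finite simple graph $G$ and $X\subseteq V(G)$, let $N_G(X)$ be the set of vertices of $V(G)\setminus X$ that have a neighbour in $X$. The graph $G$ is an $(\varepsilon_1,k)$-expander if $|N_G(X)|\ge \varepsilon(|X|,\varepsilon_1,k)\,|X|$ for every $X\subseteq V(G)$ with $k/2\le |X|\le |V(G)|/2$. For an integer $\ell\ge 0$, an $\ell$-wheel is a graph obtained from a cycle (of length at least $3$) by replacing $\ell$ of its edges with $\ell$ cycles: each of these edges $uv$ is replaced by a cycle of length at least $3$ through $u$ and $v$ all of whose other vertices are new, and the new vertices of different cycles are distinct. Lemma 2.7. For every $0<\varepsilon_1<1$ there is an $n_0$ such that for every $n\ge n_0$, every $(\varepsilon_1,15)$-expander $H$ on $n$ vertices contains, as a subgraph, an $\ell$-wheel for some $$\ell\ \ge\ \Big(\frac{\varepsilon_1}{20}\Big)^{16}\cdot\frac{2n}{\log^{16} n}.$$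 -/

import Mathlib

noncomputable section

namespace SublinearExpander

/-- The expansion function `ε(x, ε₁, k)`, with `log` the natural logarithm. -/
def expansion (ε₁ k x : ℝ) : ℝ :=
  open Classical in if x < k / 5 then 0 else ε₁ / Real.log (15 * x / k) ^ 2

/-- The external neighbourhood `N_G(X)`: the vertices outside `X` that have a neighbour in `X`. -/
def extNbhd {V : Type*} [Fintype V] (G : SimpleGraph V) (X : Finset V) : Finset V :=
  open Classical in Finset.univ.filter (fun v => v ∉ X ∧ ∃ u ∈ X, G.Adj u v)

/-- `G` is an `(ε₁, k)`-expander: `|N_G(X)| ≥ ε(|X|) · |X|` for every set `X` of vertices with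
`k / 2 ≤ |X| ≤ |V(G)| / 2`. -/
def IsExpander {V : Type*} [Fintype V] (G : SimpleGraph V) (ε₁ k : ℝ) : Prop :=
  ∀ X : Finset V, k / 2 ≤ (X.card : ℝ) → (X.card : ℝ) ≤ (Fintype.card V : ℝ) / 2 →
    expansion ε₁ k (X.card : ℝ) * (X.card : ℝ) ≤ ((extNbhd G X).card : ℝ)

/-- A subgraph is a (simple) cycle. -/
def IsCycleSubgraph {V : Type*} {G : SimpleGraph V} (C : G.Subgraph) : Prop :=
  ∃ (u : V) (c : G.Walk u u), c.IsCycle ∧ C = c.toSubgraph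

/-- The subgraph `W` of `G` is an `ℓ`-wheel: it arises from a cycle `v 0, v 1, …, v (m - 1)`
of length `m ≥ 3` by replacing `ℓ` of its edges with cycles.

The `i`-th edge of the base cycle joins `v i` to `v (i + 1)`, with indices modulo `m`, and `S` is
the set of the (indices of the) `ℓ` edges that are replaced. The piece `P i` of `W` is that edge
itself if `i ∉ S`, and a cycle through its two ends if `i ∈ S`. Different pieces meet only in the
common ends of the two base edges that they stem from. -/
def IsWheel {V : Type*} {G : SimpleGraph V} (W : G.Subgraph) (ℓ : ℕ) : Prop :=
  ∃ (m : ℕ) (v : ZMod m → V) (S : Finset (ZMod m)) (P : ZMod m → G.Subgraph),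
    3 ≤ m ∧ Function.Injective v ∧ S.card = ℓ ∧
    (∀ i, i ∉ S → ∃ h : G.Adj (v i) (v (i + 1)), P i = G.subgraphOfAdj h) ∧
    (∀ i, i ∈ S → IsCycleSubgraph (P i) ∧ v i ∈ (P i).verts ∧ v (i + 1) ∈ (P i).verts) ∧
    (∀ i j, i ≠ j →
      (P i).verts ∩ (P j).verts ⊆ ({v i, v (i + 1)} : Set V) ∩ {v j, v (j + 1)}) ∧
    W = ⨆ i, P i

end SublinearExpander

end

/-! Put δ = ε₁ / log² n. Every set `X` with at least 8 and at most n/2 vertices has at least δ|X|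
outside neighbours (`IsExpander.hasExpansion`). Let ρ be of order (log n)/δ. Two consequences are
used. Two sets that avoid a set `F` of at most a δ/2 fraction of the size of each are joined by a
walk of length at most 2ρ outside `F` (`exists_near_of_large`). And deleting fewer than δn/4
vertices cannot leave only components of at most n/8 vertices (`false_of_small_components`).

The building block is a dumbbell: a cycle of length O(ρ²) that meets two disjoint connected sets of
diameter O(ρ) and prescribed size. To find one outside a small set `U`, most of the remaining graph
is divided into connected cells around cores of size `s`, and the graph of cells is carved into
pieces of small radius. An edge between two cells of one piece closes to a short cycle through the
centre, which gives a dumbbell unless the edge meets one of a few connecting vertices. If there were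
no dumbbell, deleting a small set would leave only small components (`exists_dumbbell`).

A dumbbell is a gadget: from any of its vertices one can pass through its cycle and leave at any
vertex of a large exit set, using only O(ρ²) vertices, whereas the exit set has order ρ²/δ. Repeated
choice gives many disjoint gadgets (`exists_gadget_family`).

Depth first search links gadgets into a chain (`exists_chain`). The last gadget is abandoned when no
unused gadget can be reached from its exit set by a short walk avoiding the vertices in use or
discarded; only its small core and the link into it are then discarded for good. Abandoned exit sets
therefore stay separated from unused gadgets by a small set, so by expansion only few gadgets can be
abandoned.

In a chain of 3t gadgets the middle t form a necklace with t cycles and few vertices. The exit sets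
of the two outer thirds are so large that expansion joins them around the necklace, which closes it
to a wheel (`IsChain.exists_wheel`). The count permits t of order ε₁⁵ n / log¹² n, more than is
needed. -/

namespace SublinearExpander

open scoped Classical

universe u

/-! ### Bounded walks inside a vertex set -/

section Walks

variable {V : Type u}

/-- The spanning subgraph of `G` formed by the edges with both ends in `S`. -/
def within (G : SimpleGraph V) (S : Set V) : SimpleGraph V where
  Adj x y := G.Adj x y ∧ x ∈ S ∧ y ∈ S
  symm := ⟨fun _ _ h => ⟨h.1.symm, h.2.2, h.2.1⟩⟩
  loopless := ⟨fun _ h => h.1.ne rfl⟩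

/-- There is a walk of length at most `k` from `x` to `y`. -/
def Near (G : SimpleGraph V) (k : ℕ) (x y : V) : Prop :=
  ∃ w : G.Walk x y, w.length ≤ k

theorem Near.refl (G : SimpleGraph V) (k : ℕ) (x : V) : Near G k x x :=
  ⟨.nil, Nat.zero_le _⟩

theorem Near.symm {G : SimpleGraph V} {k : ℕ} {x y : V} (h : Near G k x y) : Near G k y x := by
  obtain ⟨w, hw⟩ := h
  exact ⟨w.reverse, by simpa using hw⟩

theorem Near.trans {G : SimpleGraph V} {k l : ℕ} {x y z : V} (h : Near G k x y)
    (h' : Near G l y z) : Near G (k + l) x z := by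
  obtain ⟨w, hw⟩ := h
  obtain ⟨w', hw'⟩ := h'
  exact ⟨w.append w', by rw [SimpleGraph.Walk.length_append]; omega⟩

theorem Near.mono {G G' : SimpleGraph V} {k l : ℕ} {x y : V} (h : Near G k x y)
    (hG : G ≤ G') (hkl : k ≤ l) : Near G' l x y := by
  obtain ⟨w, hw⟩ := h
  exact ⟨w.mapLe hG, by simpa using hw.trans hkl⟩

theorem Near.of_adj {G : SimpleGraph V} {x y : V} (h : G.Adj x y) : Near G 1 x y :=
  ⟨.cons h .nil, by simp⟩

theorem within_le (G : SimpleGraph V) (S : Set V) : within G S ≤ G := fun _ _ h => h.1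

theorem within_mono (G : SimpleGraph V) {S T : Set V} (h : S ⊆ T) : within G S ≤ within G T :=
  fun _ _ h' => ⟨h'.1, h h'.2.1, h h'.2.2⟩

theorem support_subset_of_within {G : SimpleGraph V} {S : Set V} {x y : V}
    (w : (within G S).Walk x y) (hx : x ∈ S) : ∀ v ∈ w.support, v ∈ S := by
  induction w with
  | nil => simpa using hx
  | cons h p ih =>
    intro v hv
    rw [SimpleGraph.Walk.support_cons, List.mem_cons] at hv
    rcases hv with rfl | hv
    · exact hx
    · exact ih h.2.2 v hv

theorem exists_walk_within {G : SimpleGraph V} {S : Set V} {x y : V} (w : G.Walk x y)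
    (hw : ∀ v ∈ w.support, v ∈ S) :
    ∃ w' : (within G S).Walk x y, w'.length = w.length := by
  induction w with
  | nil => exact ⟨.nil, rfl⟩
  | cons h p ih =>
    obtain ⟨p', hp'⟩ := ih fun v hv => hw v (by simp [hv])
    have h' : (within G S).Adj _ _ := ⟨h, hw _ (by simp), hw _ (by simp)⟩
    exact ⟨.cons h' p', by rw [SimpleGraph.Walk.length_cons, SimpleGraph.Walk.length_cons, hp']⟩

theorem reachable_within {G : SimpleGraph V} {S : Set V} {x y : V} (w : G.Walk x y)
    (hw : ∀ v ∈ w.support, v ∈ S) : (within G S).Reachable x y :=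
  let ⟨w', _⟩ := exists_walk_within w hw
  ⟨w'⟩

/-- A walk ending in `C` has an initial walk that meets `C` exactly in its last vertex. -/
theorem exists_first_hit {G : SimpleGraph V} {C : Set V} {x y : V} (w : G.Walk x y) (hy : y ∈ C) :
    ∃ a ∈ C, ∃ q : G.Walk x a, q.length ≤ w.length ∧
      ∀ v ∈ q.support, v ∈ w.support ∧ (v ∈ C → v = a) := by
  induction w with
  | nil => exact ⟨_, hy, .nil, le_rfl, by simp⟩
  | @cons x x' y h p ih =>
    by_cases hx : x ∈ C
    · exact ⟨x, hx, .nil, by simp, by simp⟩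
    · obtain ⟨a, ha, q, hq, hq'⟩ := ih hy
      refine ⟨a, ha, .cons h q, by simpa using hq, ?_⟩
      intro v hv
      rw [SimpleGraph.Walk.support_cons, List.mem_cons] at hv
      rcases hv with rfl | hv
      · exact ⟨by simp, fun h' => absurd h' hx⟩
      · exact ⟨by simp [(hq' v hv).1], (hq' v hv).2⟩

/-- Same as `exists_first_hit`, with a path. -/
theorem exists_path_first_hit {G : SimpleGraph V} {C : Set V} {x y : V} (w : G.Walk x y)
    (hy : y ∈ C) :
    ∃ a ∈ C, ∃ q : G.Walk x a, q.IsPath ∧ q.length ≤ w.length ∧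
      ∀ v ∈ q.support, v ∈ w.support ∧ (v ∈ C → v = a) := by
  obtain ⟨a, ha, q, hq, hq'⟩ := exists_first_hit w hy
  exact ⟨a, ha, q.bypass, q.bypass_isPath, q.length_bypass_le_length.trans hq,
    fun v hv => hq' v (q.support_bypass_subset_support hv)⟩

end Walks

/-! ### Chains of edges and cycles, and closing them to wheels -/

section Necklaces

variable {V : Type u}

/-- `Necklace G a b S ℓ`: the vertices `a` and `b` are joined in `G` by a chain of edges and cycles,
`ℓ` of them cycles, in which consecutive members share one vertex and others are disjoint; `S` is
the set of its vertices. -/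
inductive Necklace (G : SimpleGraph V) (a : V) : V → Finset V → ℕ → Prop
  | nil : Necklace G a a {a} 0
  | edge {b c : V} {S : Finset V} {ℓ : ℕ} : Necklace G a b S ℓ → G.Adj b c → c ∉ S →
      Necklace G a c (insert c S) ℓ
  | cycle {b c : V} {S : Finset V} {ℓ : ℕ} (C : G.Subgraph) (D : Finset V) : Necklace G a b S ℓ →
      IsCycleSubgraph C → (D : Set V) = C.verts → c ∈ D → c ≠ b → D ∩ S = {b} →
      Necklace G a c (S ∪ D) (ℓ + 1)

variable {G : SimpleGraph V} {a b c : V} {S S' : Finset V} {ℓ ℓ' : ℕ}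

theorem Necklace.left_mem (h : Necklace G a b S ℓ) : a ∈ S := by
  induction h with
  | nil => simp
  | edge _ _ _ ih => simp [ih]
  | cycle C D _ _ _ _ _ _ ih => simp [ih]

theorem Necklace.right_mem (h : Necklace G a b S ℓ) : b ∈ S := by
  induction h with
  | nil => simp
  | edge _ _ _ ih => simp
  | cycle C D _ _ _ hc _ _ ih => simp [hc]

/-- Induction on the second chain: each of its members meets the growing union only where it meets
its own predecessors, because the two vertex sets share `b` alone. -/
theorem Necklace.append (h : Necklace G a b S ℓ) (h' : Necklace G b c S' ℓ')
    (hS : S ∩ S' = {b}) : Necklace G a c (S ∪ S') (ℓ + ℓ') := by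
  induction h' with
  | nil =>
    have : S ∪ {b} = S := Finset.union_eq_left.2 (by simpa using h.right_mem)
    simpa [this] using h
  | @edge d c S' ℓ' h' hadj hc ih =>
    have hb := h'.left_mem
    have h1 : S ∩ S' = {b} := by
      ext v
      have := Finset.ext_iff.1 hS v
      simp only [Finset.mem_inter, Finset.mem_insert, Finset.mem_singleton] at this ⊢
      constructor
      · tauto
      · rintro rfl; exact ⟨h.right_mem, hb⟩
    have h2 : c ∉ S := by
      intro hcS
      have := (Finset.ext_iff.1 hS c).1 (by simp [hcS])
      rw [Finset.mem_singleton] at this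
      exact hc (this ▸ hb)
    rw [Finset.union_insert]
    exact (ih h1).edge hadj (by simp [h2, hc])
  | @cycle d c S' ℓ' C D h' hC hD hc hcd hDS ih =>
    have hb := h'.left_mem
    have h1 : S ∩ S' = {b} := by
      ext v
      have := Finset.ext_iff.1 hS v
      simp only [Finset.mem_inter, Finset.mem_union, Finset.mem_singleton] at this ⊢
      constructor
      · tauto
      · rintro rfl; exact ⟨h.right_mem, hb⟩
    rw [← Finset.union_assoc, ← add_assoc]
    refine (ih h1).cycle C D hC hD hc hcd ?_
    rw [← hDS]
    ext v
    have := Finset.ext_iff.1 hS v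
    simp only [Finset.mem_inter, Finset.mem_union, Finset.mem_singleton] at this ⊢
    constructor
    · rintro ⟨hv, hv' | hv'⟩
      · have : v = b := this.1 ⟨hv', Or.inr hv⟩
        exact ⟨hv, this ▸ hb⟩
      · exact ⟨hv, hv'⟩
    · tauto

theorem Necklace.of_isPath {x y : V} (p : G.Walk x y) (hp : p.IsPath) :
    Necklace G x y p.support.toFinset 0 := by
  induction p with
  | nil => simpa using Necklace.nil
  | @cons x x' y h p ih =>
    rw [SimpleGraph.Walk.cons_isPath_iff] at hp
    have h1 : Necklace G x x' (insert x' {x}) 0 := Necklace.nil.edge h (by simpa using h.ne')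
    have h2 := h1.append (ih hp.1) (by
      ext v
      simp only [Finset.mem_inter, Finset.mem_insert, Finset.mem_singleton, List.mem_toFinset]
      constructor
      · rintro ⟨rfl | rfl, h'⟩
        · rfl
        · exact absurd h' hp.2
      · rintro rfl; simp)
    have h3 : (insert x' {x} ∪ p.support.toFinset : Finset V)
        = (SimpleGraph.Walk.cons h p).support.toFinset := by
      ext v
      simp only [Finset.mem_union, Finset.mem_insert, Finset.mem_singleton, List.mem_toFinset,
        SimpleGraph.Walk.support_cons, List.mem_cons]
      constructor
      · rintro ((rfl | rfl) | h')
        · simp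
        · simp
        · simp [h']
      · tauto
    rw [h3] at h2
    simpa using h2

theorem IsCycleSubgraph.reachable {C : G.Subgraph} (hC : IsCycleSubgraph C) {x y : V}
    (hx : x ∈ C.verts) (hy : y ∈ C.verts) : (within G C.verts).Reachable x y := by
  obtain ⟨u, c, hc, rfl⟩ := hC
  rw [SimpleGraph.Walk.mem_verts_toSubgraph] at hx hy
  have key : ∀ z, z ∈ c.support → (within G c.toSubgraph.verts).Reachable u z := fun z hz =>
    reachable_within (c.takeUntil z hz) fun v hv => by
      rw [SimpleGraph.Walk.mem_verts_toSubgraph]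
      exact c.support_takeUntil_subset_support hz hv
  exact (key x hx).symm.trans (key y hy)

/-- The outer parts of a long chain are used merely as connected sets when its middle is closed to a
wheel. -/
theorem Necklace.reachable (h : Necklace G a b S ℓ) : (within G (S : Set V)).Reachable a b := by
  induction h with
  | nil => rfl
  | @edge b c S ℓ h hadj hc ih =>
    refine (ih.mono (within_mono G (by simp))).trans (SimpleGraph.Adj.reachable ⟨hadj, ?_, ?_⟩)
    · simp [h.right_mem]
    · simp
  | @cycle b c S ℓ C D h hC hD hc hcb hDS ih =>
    refine (ih.mono (within_mono G (by simp))).trans ?_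
    have hb : b ∈ D := (Finset.mem_inter.1 (hDS ▸ Finset.mem_singleton_self b : b ∈ D ∩ S)).1
    refine (hC.reachable (hD ▸ hb) (hD ▸ hc)).mono (within_mono G ?_)
    rw [← hD]; simp

/-- The members of a chain, indexed by natural numbers. -/
structure Pieces (G : SimpleGraph V) (a b : V) (S : Finset V) (ℓ k : ℕ) (v : ℕ → V)
    (P : ℕ → G.Subgraph) (J : Finset ℕ) : Prop where
  left : v 0 = a
  right : v k = b
  subset : ∀ j ∈ J, j < k
  card : J.card = ℓ
  inj : ∀ i ≤ k, ∀ j ≤ k, v i = v j → i = j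
  verts_subset : ∀ i < k, (P i).verts ⊆ S
  mem : ∀ i ≤ k, v i ∈ S
  edge : ∀ i < k, i ∉ J → ∃ h : G.Adj (v i) (v (i + 1)), P i = G.subgraphOfAdj h
  cycle : ∀ i ∈ J, IsCycleSubgraph (P i)
  mem_left : ∀ i < k, v i ∈ (P i).verts
  mem_right : ∀ i < k, v (i + 1) ∈ (P i).verts
  eq_or : ∀ i < k, ∀ j ≤ k, v j ∈ (P i).verts → j = i ∨ j = i + 1
  inter : ∀ i < k, ∀ j < k, i ≠ j →
    (P i).verts ∩ (P j).verts ⊆ ({v i, v (i + 1)} : Set V) ∩ {v j, v (j + 1)}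

/-- Edges and cycles are appended by one argument and differ only in `hJ`. The new member meets the
old ones in `b = v k` alone, and by `eq_or` this vertex lies in no old piece but the last, so the
intersection condition survives. -/
theorem Pieces.snoc {k : ℕ} {v : ℕ → V} {P : ℕ → G.Subgraph} {J : Finset ℕ}
    (h : Pieces G a b S ℓ k v P J) (Q : G.Subgraph) (S' : Finset V) (hS' : S ⊆ S')
    (hQ : Q.verts ⊆ S') (hb : b ∈ Q.verts) (hc : c ∈ Q.verts) (hcS : c ∉ S)
    (hQS : ∀ x ∈ Q.verts, x ∈ S → x = b) (J' : Finset ℕ) (ℓ' : ℕ)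
    (hJ : (J' = J ∧ ℓ' = ℓ ∧ ∃ h : G.Adj b c, Q = G.subgraphOfAdj h) ∨
      (J' = insert k J ∧ ℓ' = ℓ + 1 ∧ IsCycleSubgraph Q)) :
    Pieces G a c S' ℓ' (k + 1) (fun i => if i ≤ k then v i else c)
      (fun i => if i < k then P i else Q) J' := by
  have hkJ : k ∉ J := fun h' => lt_irrefl _ (h.subset k h')
  have hvc : ∀ i ≤ k, v i ≠ c := fun i hi h' => hcS (h' ▸ h.mem i hi)
  refine ⟨by simp [h.left], by simp, ?_, ?_, ?_, ?_, ?_, ?_, ?_, ?_, ?_, ?_, ?_⟩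
  · intro j hj
    rcases hJ with ⟨rfl, -⟩ | ⟨rfl, -⟩
    · exact (h.subset j hj).trans (Nat.lt_succ_self k)
    · rcases Finset.mem_insert.1 hj with rfl | hj
      · exact Nat.lt_succ_self _
      · exact (h.subset j hj).trans (Nat.lt_succ_self k)
  · rcases hJ with ⟨rfl, rfl, -⟩ | ⟨rfl, rfl, -⟩
    · exact h.card
    · rw [Finset.card_insert_of_notMem hkJ, h.card]
  · intro i hi j hj hij
    split_ifs at hij with h1 h2 h2
    · exact h.inj i h1 j h2 hij
    · exact absurd hij (hvc i h1)
    · exact absurd hij.symm (hvc j h2)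
    · omega
  · intro i hi
    split_ifs with h1
    · exact (h.verts_subset i h1).trans (by exact_mod_cast hS')
    · exact hQ
  · intro i hi
    split_ifs with h1
    · exact hS' (h.mem i h1)
    · exact_mod_cast hQ hc
  · intro i hi hiJ
    by_cases hik : i < k
    · have : i ∉ J := by
        rcases hJ with ⟨rfl, -⟩ | ⟨rfl, -⟩
        · exact hiJ
        · exact fun h' => hiJ (Finset.mem_insert_of_mem h')
      have h1 : i + 1 ≤ k := hik
      simpa [hik, hik.le, h1] using h.edge i hik this
    · obtain rfl : i = k := by omega
      rcases hJ with ⟨rfl, -, hadj⟩ | ⟨rfl, -⟩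
      · simpa [h.right] using hadj
      · simp at hiJ
  · intro i hi
    by_cases hik : i < k
    · have : i ∈ J := by
        rcases hJ with ⟨rfl, -⟩ | ⟨rfl, -⟩
        · exact hi
        · rcases Finset.mem_insert.1 hi with rfl | hi
          · omega
          · exact hi
      simpa [hik] using h.cycle i this
    · rcases hJ with ⟨rfl, -⟩ | ⟨rfl, -, hcyc⟩
      · exact absurd (h.subset i hi) hik
      · simpa [hik] using hcyc
  · intro i hi
    by_cases hik : i < k
    · simpa [hik, hik.le] using h.mem_left i hik
    · obtain rfl : i = k := by omega
      simpa [h.right] using hb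
  · intro i hi
    by_cases hik : i < k
    · have h1 : i + 1 ≤ k := hik
      simpa [hik, h1] using h.mem_right i hik
    · obtain rfl : i = k := by omega
      simpa using hc
  · intro i hi j hj hij
    split_ifs at hij with h1 h2 h2
    · exact h.eq_or i h1 j h2 hij
    · exact absurd (h.verts_subset i h1 hij) (by simpa using hcS)
    · have : v j = v k := by rw [h.right]; exact hQS _ hij (h.mem j h2)
      have := h.inj j h2 k le_rfl this
      omega
    · omega
  · have key : ∀ i < k, (P i).verts ∩ Q.verts ⊆ ({v i, v (i + 1)} : Set V) ∩ {b, c} := by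
      rintro i hi x ⟨hx, hx'⟩
      have hxb := hQS x hx' (by exact_mod_cast h.verts_subset i hi hx)
      subst hxb
      have := h.eq_or i hi k le_rfl (by rw [h.right]; exact hx)
      refine ⟨?_, by simp⟩
      rcases this with h' | h'
      · omega
      · rw [← h', h.right]; simp
    intro i hi j hj hij
    by_cases h1 : i < k <;> by_cases h2 : j < k
    · have h3 : i + 1 ≤ k := h1
      have h4 : j + 1 ≤ k := h2
      simpa [h1, h2, h1.le, h2.le, h3, h4] using h.inter i h1 j h2 hij
    · obtain rfl : j = k := by omega
      have h3 : i + 1 ≤ j := h1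
      simpa [h1, h1.le, h3, h.right] using key i h1
    · obtain rfl : i = k := by omega
      have h4 : j + 1 ≤ i := h2
      have := key j h2
      rw [Set.inter_comm, Set.inter_comm {v j, _}] at this
      simpa [h2, h2.le, h4, h.right] using this
    · omega

theorem Necklace.exists_pieces (h : Necklace G a b S ℓ) :
    ∃ (k : ℕ) (v : ℕ → V) (P : ℕ → G.Subgraph) (J : Finset ℕ), Pieces G a b S ℓ k v P J := by
  induction h with
  | nil =>
    refine ⟨0, fun _ => a, fun _ => ⊥, ∅, ?_⟩
    constructor <;> simp
  | @edge b c S ℓ h hadj hc ih =>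
    obtain ⟨k, v, P, J, hP⟩ := ih
    refine ⟨_, _, _, J, hP.snoc (G.subgraphOfAdj hadj) _ (Finset.subset_insert c S) ?_ ?_ ?_ hc ?_ _ _
      (Or.inl ⟨rfl, rfl, hadj, rfl⟩)⟩
    · intro x hx
      rcases hx with rfl | rfl
      · simp [h.right_mem]
      · simp
    · simp
    · simp
    · intro x hx hxS
      rcases hx with rfl | rfl
      · rfl
      · exact absurd hxS hc
  | @cycle b c S ℓ C D h hC hD hc hcb hDS ih =>
    obtain ⟨k, v, P, J, hP⟩ := ih
    have hb : b ∈ D := (Finset.mem_inter.1 (hDS ▸ Finset.mem_singleton_self b : b ∈ D ∩ S)).1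
    have hx : ∀ x ∈ D, x ∈ S → x = b := fun x hx hxS =>
      Finset.mem_singleton.1 (hDS ▸ Finset.mem_inter.2 ⟨hx, hxS⟩)
    refine ⟨_, _, _, insert k J, hP.snoc C _ (Finset.subset_union_left) ?_ (hD ▸ hb) (hD ▸ hc)
      (fun h' => hcb (hx c hc h')) ?_ _ _ (Or.inr ⟨rfl, rfl, hC⟩)⟩
    · rw [← hD]; simp
    · intro x hxC
      rw [← hD] at hxC
      exact hx x hxC

/-- A chain with at least two cycles whose ends are adjacent closes up to a wheel. -/
theorem Necklace.exists_wheel (h : Necklace G a b S ℓ) (hadj : G.Adj b a) (hℓ : 2 ≤ ℓ) :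
    ∃ W : G.Subgraph, IsWheel W ℓ := by
  obtain ⟨k, v, P, J, hP⟩ := h.exists_pieces
  -- Two cycles occupy two positions, so that with the closing edge the base cycle has length `k + 1
  -- ≥ 3`.
  have hk : 2 ≤ k := by
    have : J ⊆ Finset.range k := fun j hj => Finset.mem_range.2 (hP.subset j hj)
    have := Finset.card_le_card this
    rw [hP.card, Finset.card_range] at this
    omega
  -- The closing edge from `b` to `a` is the piece of index `k`.
  set P' : ZMod (k + 1) → G.Subgraph := fun i =>
    if i.val < k then P i.val else G.subgraphOfAdj hadj with hP'
  have hval : ∀ i : ZMod (k + 1), i.val ≤ k := fun i => Nat.lt_succ_iff.1 (ZMod.val_lt i)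
  have hsucc : ∀ i : ZMod (k + 1), i.val < k → (i + 1).val = i.val + 1 := by
    intro i hi
    rw [ZMod.val_add, ZMod.val_one'' (by omega), Nat.mod_eq_of_lt (by omega)]
  have hlast : ∀ i : ZMod (k + 1), ¬ i.val < k → (i + 1).val = 0 := by
    intro i hi
    have : i.val = k := by have := hval i; omega
    rw [ZMod.val_add, ZMod.val_one'' (by omega), this, Nat.mod_self]
  have hinj : Function.Injective (ZMod.val : ZMod (k + 1) → ℕ) := ZMod.val_injective _
  have key : ∀ i < k, (P i).verts ∩ (G.subgraphOfAdj hadj).verts ⊆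
      ({v i, v (i + 1)} : Set V) ∩ {b, a} := by
    rintro i hi x ⟨hx, hx'⟩
    refine ⟨?_, hx'⟩
    rcases hx' with rfl | rfl
    · rw [← hP.right] at hx ⊢
      rcases hP.eq_or i hi k le_rfl hx with h' | h'
      · omega
      · rw [h']; simp
    · rw [← hP.left] at hx ⊢
      rcases hP.eq_or i hi 0 (Nat.zero_le _) hx with h' | h'
      · rw [← h']; simp
      · omega
  refine ⟨⨆ i, P' i, k + 1, fun i => v i.val, Finset.univ.filter (fun i => i.val ∈ J), P', by omega,
    ?_, ?_, ?_, ?_, ?_, rfl⟩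
  · intro i j hij
    exact hinj (hP.inj _ (hval i) _ (hval j) hij)
  · rw [← hP.card]
    refine Finset.card_bij (fun i _ => i.val) (by simp) (fun i _ j _ hij => hinj hij) ?_
    intro j hj
    have := hP.subset j hj
    refine ⟨(j : ZMod (k + 1)), ?_, ?_⟩
    · simp [ZMod.val_cast_of_lt (show j < k + 1 by omega), hj]
    · rw [ZMod.val_cast_of_lt (show j < k + 1 by omega)]
  · intro i hi
    by_cases hik : i.val < k
    · have := hP.edge i.val hik (by simpa using hi)
      simpa [hP', hik, hsucc i hik] using this
    · have h1 : i.val = k := by have := hval i; omega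
      have h2 := hlast i hik
      simp only [hP', lt_irrefl, if_false, h1, h2, hP.left, hP.right]
      exact ⟨hadj, trivial⟩
  · intro i hi
    have hiJ : i.val ∈ J := by simpa using hi
    have hik := hP.subset _ hiJ
    simp only [hP', hik, if_true, hsucc i hik]
    exact ⟨hP.cycle _ hiJ, hP.mem_left _ hik, hP.mem_right _ hik⟩
  · intro i j hij
    by_cases h1 : i.val < k <;> by_cases h2 : j.val < k
    · simp only [hP', h1, h2, if_true, hsucc _ h1, hsucc _ h2]
      exact hP.inter _ h1 _ h2 fun h' => hij (hinj h')
    · have h3 : j.val = k := by have := hval j; omega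
      simp only [hP', h1, lt_irrefl, if_true, if_false, hsucc _ h1, hlast _ h2, h3, hP.left, hP.right]
      exact key _ h1
    · have h3 : i.val = k := by have := hval i; omega
      simp only [hP', h2, lt_irrefl, if_true, if_false, hsucc _ h2, hlast _ h1, h3, hP.left, hP.right]
      have := key _ h2
      rwa [Set.inter_comm, Set.inter_comm {v j.val, _}] at this
    · exact absurd (hinj (by have := hval i; have := hval j; omega)) hij

/-- A chain with at least two cycles whose ends are joined outside it is part of a wheel. -/
theorem Necklace.exists_wheel_of_reachable (h : Necklace G a b S ℓ) (hℓ : 2 ≤ ℓ) (hab : a ≠ b)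
    (hr : (within G {v | v ∈ S → v = a ∨ v = b}).Reachable b a) :
    ∃ W : G.Subgraph, IsWheel W ℓ := by
  obtain ⟨p, hp⟩ := hr.symm.exists_isPath
  have hsup := support_subset_of_within p (by simp)
  -- The first edge of the outside path from `a` is kept as the closing edge; the rest, reversed,
  -- prolongs the chain from `b`.
  cases p with
  | nil => exact absurd rfl hab
  | @cons _ d _ had q =>
    rw [SimpleGraph.Walk.cons_isPath_iff] at hp
    set q' := (q.mapLe (within_le G _)).reverse with hq'
    have hpath : q'.IsPath := (hp.1.mapLe _).reverse
    have hs : ∀ v, v ∈ q'.support ↔ v ∈ q.support := by simp [hq']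
    have h1 := h.append (Necklace.of_isPath q' hpath) (by
      ext v
      simp only [Finset.mem_inter, List.mem_toFinset, Finset.mem_singleton, hs]
      constructor
      · rintro ⟨hvS, hv⟩
        rcases hsup v (by simp [hv]) hvS with rfl | rfl
        · exact absurd hv hp.2
        · rfl
      · rintro rfl
        exact ⟨h.right_mem, by simp⟩)
    exact h1.exists_wheel had.1.symm hℓ

end Necklaces

/-! ### Ball growing and carving -/

section Balls

variable {ι : Type u}

/-- The ball of radius `j` around the set `A`, growing inside `R`. -/
noncomputable def ball (Γ : SimpleGraph ι) (R A : Finset ι) : ℕ → Finset ι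
  | 0 => A
  | j + 1 => ball Γ R A j ∪ R.filter (fun v => ∃ u ∈ ball Γ R A j, Γ.Adj u v)

theorem ball_mono (Γ : SimpleGraph ι) (R A : Finset ι) : Monotone (ball Γ R A) :=
  monotone_nat_of_le_succ fun _ => Finset.subset_union_left

theorem ball_subset {Γ : SimpleGraph ι} {R A : Finset ι} (hA : A ⊆ R) (j : ℕ) :
    ball Γ R A j ⊆ R := by
  induction j with
  | zero => exact hA
  | succ j ih => exact Finset.union_subset ih (Finset.filter_subset _ _)

theorem exists_near_of_mem_ball {Γ : SimpleGraph ι} {R A : Finset ι} (hA : A ⊆ R) (j : ℕ) :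
    ∀ x ∈ ball Γ R A j, ∃ a ∈ A, Near (within Γ R) j a x := by
  induction j with
  | zero => exact fun x hx => ⟨x, hx, Near.refl _ _ _⟩
  | succ j ih =>
    intro x hx
    rcases Finset.mem_union.1 hx with hx | hx
    · obtain ⟨a, ha, h⟩ := ih x hx
      exact ⟨a, ha, h.mono le_rfl (Nat.le_succ j)⟩
    · obtain ⟨hxR, y, hy, hyx⟩ := Finset.mem_filter.1 hx
      obtain ⟨a, ha, h⟩ := ih y hy
      exact ⟨a, ha, h.trans (Near.of_adj ⟨hyx, ball_subset hA j hy, hxR⟩)⟩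

theorem pow_mul_le_of_growth {f : ℕ → ℝ} {q : ℝ} (hq : 0 ≤ q) {r : ℕ}
    (h : ∀ j < r, q * f j ≤ f (j + 1)) : q ^ r * f 0 ≤ f r := by
  induction r with
  | zero => simp
  | succ r ih =>
    have h1 := ih fun j hj => h j (hj.trans (Nat.lt_succ_self r))
    calc q ^ (r + 1) * f 0 = q * (q ^ r * f 0) := by ring
      _ ≤ q * f r := mul_le_mul_of_nonneg_left h1 hq
      _ ≤ f (r + 1) := h r (Nat.lt_succ_self r)

/-- Ball carving: after deleting a set of small weight, every component has small radius. The
component of `x` is recorded by its centre `c x`, and `h` decreases towards the centre. -/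
theorem exists_carving [Fintype ι] (Γ : SimpleGraph ι) (w : ι → ℕ) (hw : ∀ i, 1 ≤ w i) {η : ℝ} (hη : 0 < η)
    {n ρ : ℕ} (hn : ∑ i, w i ≤ n) (hρ : (n : ℝ) < (1 + η) ^ ρ) (R : Finset ι) :
    ∃ (A : Finset ι) (h : ι → ℕ) (c : ι → ι), A ⊆ R ∧
      ((∑ i ∈ R \ A, w i : ℕ) : ℝ) ≤ η * ((∑ i ∈ A, w i : ℕ) : ℝ) ∧
      (∀ x ∈ A, h x ≤ ρ ∧ c x ∈ A ∧ c (c x) = c x ∧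
        (x = c x ∨ ∃ y ∈ A, Γ.Adj x y ∧ c y = c x ∧ h y < h x)) ∧
      ∀ x ∈ A, ∀ y ∈ A, Γ.Adj x y → c x = c y := by
  induction R using Finset.strongInduction with
  | H R ih =>
  rcases R.eq_empty_or_nonempty with rfl | ⟨z, hz⟩
  · exact ⟨∅, fun _ => 0, id, by simp⟩
  set B := ball Γ R {z} with hB
  have hBR : ∀ j, B j ⊆ R := fun j => ball_subset (by simpa using hz) j
  -- If each of the first ρ balls grew by the factor 1 + η, the last would have weight above n. At
  -- the slow radius `j` the ball is kept, its boundary layer is deleted at a cost of η times the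
  -- ball, and the rest is carved by induction.
  obtain ⟨j, hj, hgrow⟩ : ∃ j < ρ,
      ((∑ i ∈ B (j + 1), w i : ℕ) : ℝ) < (1 + η) * ((∑ i ∈ B j, w i : ℕ) : ℝ) := by
    by_contra! hcon
    have h1 := pow_mul_le_of_growth (f := fun j => ((∑ i ∈ B j, w i : ℕ) : ℝ)) (by positivity) hcon
    have h2 : ((∑ i ∈ B ρ, w i : ℕ) : ℝ) ≤ n := by
      exact_mod_cast (Finset.sum_le_sum_of_subset (Finset.subset_univ _)).trans hn
    have h3 : (1 : ℝ) ≤ ((∑ i ∈ B 0, w i : ℕ) : ℝ) := by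
      simpa [hB, ball] using hw z
    have h4 : (0 : ℝ) ≤ (1 + η) ^ ρ := by positivity
    nlinarith
  have hzB : ∀ i, z ∈ B i := fun i => ball_mono Γ R {z} (Nat.zero_le i) (by simp [ball])
  have hlt : R \ B (j + 1) ⊂ R := by
    refine Finset.ssubset_iff_subset_ne.2 ⟨Finset.sdiff_subset, fun h => ?_⟩
    have := h ▸ hz
    exact (Finset.mem_sdiff.1 this).2 (hzB _)
  obtain ⟨A, h, c, hAR, hA, hc, hadj⟩ := ih _ hlt
  have hBA : ∀ x ∈ A, x ∉ B j := fun x hx hxB =>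
    (Finset.mem_sdiff.1 (hAR hx)).2 (ball_mono Γ R {z} (Nat.le_succ j) hxB)
  -- The height of a vertex of the new ball is the first radius at which it appears; outside all
  -- balls the value 0 is never used.
  let d : ι → ℕ := fun x => if hx : ∃ i, x ∈ B i then Nat.find hx else 0
  have hd : ∀ x i, x ∈ B i → d x ≤ i ∧ x ∈ B (d x) := by
    intro x i hx
    have hx' : ∃ i, x ∈ B i := ⟨i, hx⟩
    simp only [d, hx', dif_pos]
    exact ⟨Nat.find_min' hx' hx, Nat.find_spec hx'⟩
  have hcross : ∀ x ∈ B j, ∀ y ∈ A, ¬ Γ.Adj x y := by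
    intro x hx y hy hxy
    have := Finset.mem_sdiff.1 (hAR hy)
    exact this.2 (Finset.mem_union_right _ (Finset.mem_filter.2 ⟨this.1, x, hx, hxy⟩))
  refine ⟨B j ∪ A, fun x => if x ∈ B j then d x else h x, fun x => if x ∈ B j then z else c x,
    Finset.union_subset (hBR j) (hAR.trans Finset.sdiff_subset), ?_, ?_, ?_⟩
  · have h1 : R \ (B j ∪ A) ⊆ (B (j + 1) \ B j) ∪ ((R \ B (j + 1)) \ A) := by
      intro x hx
      simp only [Finset.mem_sdiff, Finset.mem_union] at hx ⊢
      tauto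
    have h2 : ∑ i ∈ R \ (B j ∪ A), w i ≤
        ∑ i ∈ B (j + 1) \ B j, w i + ∑ i ∈ (R \ B (j + 1)) \ A, w i :=
      (Finset.sum_le_sum_of_subset h1).trans (Finset.sum_union_inter (f := w) ▸ Nat.le_add_right _ _)
    have h3 : ∑ i ∈ B (j + 1) \ B j, w i + ∑ i ∈ B j, w i = ∑ i ∈ B (j + 1), w i :=
      Finset.sum_sdiff (ball_mono Γ R {z} (Nat.le_succ j))
    have h4 : ∑ i ∈ B j ∪ A, w i = ∑ i ∈ B j, w i + ∑ i ∈ A, w i :=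
      Finset.sum_union (Finset.disjoint_right.2 hBA)
    rw [h4]
    have h2' : ((∑ i ∈ R \ (B j ∪ A), w i : ℕ) : ℝ) ≤
        ((∑ i ∈ B (j + 1) \ B j, w i : ℕ) : ℝ) + ((∑ i ∈ (R \ B (j + 1)) \ A, w i : ℕ) : ℝ) := by
      exact_mod_cast h2
    have h3' : ((∑ i ∈ B (j + 1) \ B j, w i : ℕ) : ℝ) + ((∑ i ∈ B j, w i : ℕ) : ℝ)
        = ((∑ i ∈ B (j + 1), w i : ℕ) : ℝ) := by exact_mod_cast h3
    rw [Nat.cast_add]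
    linarith
  · intro x hx
    by_cases hxB : x ∈ B j
    · simp only [hxB, if_true, hzB j]
      refine ⟨((hd x j hxB).1).trans hj.le, by simp [hzB], trivial, ?_⟩
      rcases Nat.eq_zero_or_pos (d x) with h0 | h0
      · left
        have := (hd x j hxB).2
        rw [h0] at this
        simpa [hB, ball] using this
      · right
        obtain ⟨i, hi⟩ : ∃ i, d x = i + 1 := ⟨d x - 1, by omega⟩
        have hxi := (hd x j hxB).2
        rw [hi] at hxi
        rcases Finset.mem_union.1 hxi with h' | h'
        · have := (hd x i h').1; omega
        · obtain ⟨-, y, hy, hyx⟩ := Finset.mem_filter.1 h'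
          have hij : i ≤ j := by have := (hd x j hxB).1; omega
          have hyj : y ∈ B j := ball_mono Γ R {z} hij hy
          refine ⟨y, by simp [hyj], hyx.symm, by simp [hyj], ?_⟩
          have := (hd y i hy).1
          simp only [hyj, if_true]
          omega
    · have hxA : x ∈ A := by simpa [hxB] using hx
      obtain ⟨h1, h2, h3, h4⟩ := hc x hxA
      have h5 := hBA _ h2
      simp only [hxB, if_false, h5]
      refine ⟨h1, by simp [h2], h3, ?_⟩
      rcases h4 with h4 | ⟨y, hy, hxy, hyc, hyh⟩
      · exact Or.inl h4
      · exact Or.inr ⟨y, by simp [hy], hxy, by simp [hBA y hy, hyc], by simp [hBA y hy, hyh]⟩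
  · intro x hx y hy hxy
    by_cases hxB : x ∈ B j <;> by_cases hyB : y ∈ B j
    · simp [hxB, hyB]
    · exact absurd hxy (hcross x hxB y (by simpa [hyB] using hy))
    · exact absurd hxy.symm (hcross y hyB x (by simpa [hxB] using hx))
    · simp only [hxB, hyB, if_false]
      exact hadj x (by simpa [hxB] using hx) y (by simpa [hyB] using hy) hxy

end Balls

/-! ### Connectivity consequences of expansion -/

section Expansion

variable {V : Type u} [Fintype V]

/-- Every vertex set of size between `8` and half of the order expands by the factor `δ`. -/
def HasExpansion (H : SimpleGraph V) (δ : ℝ) : Prop :=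
  ∀ X : Finset V, 8 ≤ X.card → 2 * X.card ≤ Fintype.card V →
    δ * X.card ≤ (extNbhd H X).card

/-- For `k = 15` the lower limit `k / 2` amounts to 8 vertices and `15x / k` is `x`. The rate ε₁ /
log² x decreases in `x`, so its value at n serves all sizes. -/
theorem IsExpander.hasExpansion {H : SimpleGraph V} {ε₁ : ℝ} (hε : 0 < ε₁)
    (h : IsExpander H ε₁ 15) :
    HasExpansion H (ε₁ / Real.log (Fintype.card V) ^ 2) := by
  intro X h8 h2
  have h8' : (8 : ℝ) ≤ X.card := by exact_mod_cast h8
  have h2' : 2 * (X.card : ℝ) ≤ Fintype.card V := by exact_mod_cast h2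
  have h1 := h X (by linarith) (by linarith)
  refine le_trans ?_ h1
  refine mul_le_mul_of_nonneg_right ?_ (Nat.cast_nonneg _)
  rw [expansion, if_neg (by norm_num; linarith)]
  have h3 : 15 * (X.card : ℝ) / 15 = X.card := by ring
  rw [h3]
  have h4 : 0 < Real.log (X.card : ℝ) := Real.log_pos (by linarith)
  have h5 : Real.log (X.card : ℝ) ≤ Real.log (Fintype.card V) :=
    Real.log_le_log (by linarith) (by linarith)
  exact div_le_div_of_nonneg_left hε.le (by positivity) (pow_le_pow_left₀ h4.le h5 2)

variable {H : SimpleGraph V} {δ : ℝ}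

/-- While the ball covers at most half of the graph, expansion offers it δ|ball| new vertices, and
`F` can block at most half of that number. Growth by 1 + δ/2 in each of ρ rounds would exceed n. -/
theorem card_lt_two_mul_card_ball (hH : HasExpansion H δ) (hδ : 0 < δ) {ρ : ℕ}
    (hρ : (Fintype.card V : ℝ) < (1 + δ / 2) ^ ρ) {A F : Finset V} (hA : 8 ≤ A.card)
    (hF : (F.card : ℝ) ≤ δ / 2 * A.card) :
    Fintype.card V < 2 * (ball H Fᶜ A ρ).card := by
  by_contra! hcon
  have hmono : ∀ i j, i ≤ j → (ball H Fᶜ A i).card ≤ (ball H Fᶜ A j).card :=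
    fun i j hij => Finset.card_le_card (ball_mono H _ A hij)
  have hgrow : ∀ j < ρ, (1 + δ / 2) * ((ball H Fᶜ A j).card : ℝ) ≤ (ball H Fᶜ A (j + 1)).card := by
    intro j hj
    have h0 : A.card ≤ (ball H Fᶜ A j).card := hmono 0 j (Nat.zero_le j)
    have h1 := hH (ball H Fᶜ A j) (hA.trans h0) (by have := hmono j ρ hj.le; omega)
    have h2 : ball H Fᶜ A j ∪ extNbhd H (ball H Fᶜ A j) ⊆ ball H Fᶜ A (j + 1) ∪ F := by
      intro x hx
      by_cases hxF : x ∈ F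
      · simp [hxF]
      · refine Finset.mem_union_left _ ?_
        rcases Finset.mem_union.1 hx with hx | hx
        · exact ball_mono H _ A (Nat.le_succ j) hx
        · refine Finset.mem_union_right _ (Finset.mem_filter.2 ⟨by simpa using hxF, ?_⟩)
          simpa [extNbhd] using (Finset.mem_filter.1 hx).2.2
    have h3 : (ball H Fᶜ A j).card + (extNbhd H (ball H Fᶜ A j)).card ≤
        (ball H Fᶜ A (j + 1)).card + F.card := by
      rw [← Finset.card_union_of_disjoint]
      · exact (Finset.card_le_card h2).trans (Finset.card_union_le _ _)
      · rw [Finset.disjoint_right]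
        intro x hx
        exact (Finset.mem_filter.1 hx).2.1
    have h3' : ((ball H Fᶜ A j).card : ℝ) + (extNbhd H (ball H Fᶜ A j)).card ≤
        (ball H Fᶜ A (j + 1)).card + F.card := by exact_mod_cast h3
    have h0' : (A.card : ℝ) ≤ (ball H Fᶜ A j).card := by exact_mod_cast h0
    nlinarith
  have h1 := pow_mul_le_of_growth (f := fun j => ((ball H Fᶜ A j).card : ℝ)) (by positivity) hgrow
  have h2 : (8 : ℝ) ≤ (ball H Fᶜ A 0).card := by exact_mod_cast hA
  have h3 : 2 * ((ball H Fᶜ A ρ).card : ℝ) ≤ Fintype.card V := by exact_mod_cast hcon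
  have h4 : (0 : ℝ) ≤ Fintype.card V := Nat.cast_nonneg _
  have h5 : (0 : ℝ) ≤ (1 + δ / 2) ^ ρ := by positivity
  nlinarith

/-- Two large sets are joined by a short walk that avoids a small set. -/
theorem exists_near_of_large (hH : HasExpansion H δ) (hδ : 0 < δ) {ρ : ℕ}
    (hρ : (Fintype.card V : ℝ) < (1 + δ / 2) ^ ρ) {A B F : Finset V} (hA : 8 ≤ A.card)
    (hFA : (F.card : ℝ) ≤ δ / 2 * A.card) (hB : 8 ≤ B.card)
    (hFB : (F.card : ℝ) ≤ δ / 2 * B.card) (hAF : Disjoint A F) (hBF : Disjoint B F) :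
    ∃ a ∈ A, ∃ b ∈ B, Near (within H (Fᶜ : Finset V)) (ρ + ρ) a b := by
  have h1 := card_lt_two_mul_card_ball hH hδ hρ hA hFA
  have h2 := card_lt_two_mul_card_ball hH hδ hρ hB hFB
  -- Each ball contains more than half of the vertices.
  have h3 : ¬ Disjoint (ball H Fᶜ A ρ) (ball H Fᶜ B ρ) := by
    intro hd
    have := Finset.card_le_univ (ball H Fᶜ A ρ ∪ ball H Fᶜ B ρ)
    rw [Finset.card_union_of_disjoint hd] at this
    omega
  obtain ⟨x, hxA, hxB⟩ := Finset.not_disjoint_iff.1 h3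
  obtain ⟨a, ha, h4⟩ := exists_near_of_mem_ball
    (fun v hv => Finset.mem_compl.2 (Finset.disjoint_left.1 hAF hv)) ρ x hxA
  obtain ⟨b, hb, h5⟩ := exists_near_of_mem_ball
    (fun v hv => Finset.mem_compl.2 (Finset.disjoint_left.1 hBF hv)) ρ x hxB
  exact ⟨a, ha, b, hb, h4.trans h5.symm⟩

/-- An expander has no small set whose deletion leaves only small components. -/
theorem false_of_small_components (hH : HasExpansion H δ) (hδ : 0 < δ) (hδ1 : δ ≤ 1)
    (hn : 32 ≤ Fintype.card V) {β : Type*} (B : Finset V) (f : V → β)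
    (hf : ∀ x, x ∉ B → ∀ y, y ∉ B → H.Adj x y → f x = f y)
    (hcl : ∀ (b : β) (S : Finset V), (∀ x ∈ S, x ∉ B ∧ f x = b) → 8 * S.card ≤ Fintype.card V)
    (hB : 4 * (B.card : ℝ) < δ * Fintype.card V) : False := by
  set n := Fintype.card V with hn'
  have hBn : 4 * B.card < n := by
    have h0 : (0 : ℝ) ≤ n := Nat.cast_nonneg _
    have : 4 * (B.card : ℝ) < n := by nlinarith
    exact_mod_cast this
  let S : Finset β → Finset V := fun J => Bᶜ.filter (fun x => f x ∈ J)
  -- Among the unions of classes with at most n/2 vertices, take a largest.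
  obtain ⟨J, hJ, hmax⟩ : ∃ J : Finset β, 2 * (S J).card ≤ n ∧
      ∀ J' : Finset β, 2 * (S J').card ≤ n → (S J').card ≤ (S J).card := by
    let Q : ℕ → Prop := fun k => ∃ J : Finset β, (S J).card = k ∧ 2 * k ≤ n
    have h0 : Q 0 := ⟨∅, by simp [S], by simp⟩
    have hQ := Nat.findGreatest_spec (P := Q) (Nat.zero_le n) h0
    obtain ⟨J, hJ, hJ2⟩ := hQ
    refine ⟨J, by rw [hJ]; exact hJ2, fun J' hJ' => ?_⟩
    rw [hJ]
    exact Nat.le_findGreatest (by omega) ⟨J', rfl, hJ'⟩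
  -- Below n/4, one more class of at most n/8 vertices would still fit. All outside neighbours of
  -- the union lie in `B`, which is too small for a set of at least n/4 vertices.
  have h4 : n ≤ 4 * (S J).card := by
    by_contra! hcon
    have : ∃ x ∈ Bᶜ, x ∉ S J := by
      by_contra! h'
      have h1 := Finset.card_le_card (show Bᶜ ⊆ S J from h')
      have h2 := Finset.card_add_card_compl B
      omega
    obtain ⟨x, hxB, hxJ⟩ := this
    have hfx : f x ∉ J := fun h' => hxJ (Finset.mem_filter.2 ⟨hxB, h'⟩)
    have h1 : S (insert (f x) J) = S J ∪ Bᶜ.filter (fun y => f y = f x) := by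
      ext y
      simp only [S, Finset.mem_filter, Finset.mem_union, Finset.mem_insert]
      tauto
    have h2 : (S (insert (f x) J)).card ≤ (S J).card + (Bᶜ.filter (fun y => f y = f x)).card := by
      rw [h1]; exact Finset.card_union_le _ _
    have h3 := hcl (f x) (Bᶜ.filter (fun y => f y = f x)) (by simp)
    have h5 := hmax (insert (f x) J) (by omega)
    have h6 : S J ⊂ S (insert (f x) J) := by
      refine Finset.ssubset_iff_subset_ne.2 ⟨by rw [h1]; exact Finset.subset_union_left, ?_⟩
      intro h'
      refine hxJ (h' ▸ ?_)
      exact Finset.mem_filter.2 ⟨hxB, Finset.mem_insert_self _ _⟩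
    have := Finset.card_lt_card h6
    omega
  have h1 := hH (S J) (by omega) hJ
  have h2 : extNbhd H (S J) ⊆ B := by
    intro x hx
    obtain ⟨-, hxS, y, hy, hyx⟩ := Finset.mem_filter.1 hx
    by_contra hxB
    obtain ⟨hyB, hyJ⟩ := Finset.mem_filter.1 hy
    refine hxS (Finset.mem_filter.2 ⟨Finset.mem_compl.2 hxB, ?_⟩)
    rwa [← hf y (Finset.mem_compl.1 hyB) x hxB hyx]
  have h3 : ((extNbhd H (S J)).card : ℝ) ≤ B.card := by exact_mod_cast Finset.card_le_card h2
  have h4' : (n : ℝ) ≤ 4 * (S J).card := by exact_mod_cast h4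
  nlinarith

end Expansion

/-! ### Sets spanned by trees of bounded height -/

section Rooted

variable {V : Type u}

/-- Any two vertices of `T` are joined by a walk of length at most `d` inside `T`. -/
def DiamLE (G : SimpleGraph V) (d : ℕ) (T : Finset V) : Prop :=
  ∀ x ∈ T, ∀ y ∈ T, Near (within G T) d x y

/-- The set `P` is spanned by a tree of height at most `ρ` rooted at `z`. -/
def IsRooted (G : SimpleGraph V) (ρ : ℕ) (P : Finset V) (z : V) : Prop :=
  z ∈ P ∧ ∃ h : V → ℕ, ∀ x ∈ P, h x ≤ ρ ∧ (x = z ∨ ∃ y ∈ P, G.Adj x y ∧ h y < h x)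

variable {G : SimpleGraph V} {ρ : ℕ} {P : Finset V} {z : V}

theorem IsRooted.near (hP : IsRooted G ρ P z) {x : V} (hx : x ∈ P) :
    Near (within G P) ρ x z := by
  obtain ⟨hz, h, hh⟩ := hP
  have key : ∀ k, ∀ x ∈ P, h x ≤ k → Near (within G P) k x z := by
    intro k
    induction k with
    | zero =>
      intro x hx hk
      rcases (hh x hx).2 with rfl | ⟨y, -, -, hy⟩
      · exact Near.refl _ _ _
      · omega
    | succ k ih =>
      intro x hx hk
      rcases (hh x hx).2 with rfl | ⟨y, hyP, hxy, hy⟩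
      · exact Near.refl _ _ _
      · have h1 : Near (within G P) 1 x y := Near.of_adj ⟨hxy, hx, hyP⟩
        exact (h1.trans (ih y hyP (by omega))).mono le_rfl (by omega)
  exact key ρ x hx (hh x hx).1

theorem IsRooted.diamLE (hP : IsRooted G ρ P z) : DiamLE G (ρ + ρ) P :=
  fun _ hx _ hy => (hP.near hx).trans (hP.near hy).symm

/-- A highest vertex other than the root is nobody's parent, since parents are strictly lower, so it
can be removed; repeat until `s` vertices remain. -/
theorem IsRooted.exists_subset_card_eq {s : ℕ} (hs : 1 ≤ s) (hP : IsRooted G ρ P z)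
    (hsP : s ≤ P.card) : ∃ Q ⊆ P, Q.card = s ∧ IsRooted G ρ Q z := by
  obtain ⟨k, hk⟩ := Nat.exists_eq_add_of_le hsP
  induction k generalizing P with
  | zero => exact ⟨P, subset_rfl, by omega, hP⟩
  | succ k ih =>
    obtain ⟨hz, h, hh⟩ := hP
    have hne : (P.erase z).Nonempty := by
      rw [← Finset.card_pos, Finset.card_erase_of_mem hz]; omega
    obtain ⟨x, hx, hmax⟩ := Finset.exists_max_image _ h hne
    obtain ⟨hxz, hxP⟩ := Finset.mem_erase.1 hx
    have hroot : IsRooted G ρ (P.erase x) z := by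
      refine ⟨Finset.mem_erase.2 ⟨hxz.symm, hz⟩, h, fun y hy => ?_⟩
      obtain ⟨hyx, hyP⟩ := Finset.mem_erase.1 hy
      refine ⟨(hh y hyP).1, ?_⟩
      rcases (hh y hyP).2 with rfl | ⟨w, hwP, hyw, hw⟩
      · exact Or.inl rfl
      · by_cases hyz : y = z
        · exact Or.inl hyz
        · have h1 := hmax y (Finset.mem_erase.2 ⟨hyz, hyP⟩)
          refine Or.inr ⟨w, Finset.mem_erase.2 ⟨?_, hwP⟩, hyw, hw⟩
          rintro rfl
          omega
    have hcard : (P.erase x).card = s + k := by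
      rw [Finset.card_erase_of_mem hxP]; omega
    obtain ⟨Q, hQ, h1, h2⟩ := ih hroot (by omega) hcard
    exact ⟨Q, hQ.trans (Finset.erase_subset _ _), h1, h2⟩

theorem DiamLE.union {T T' : Finset V} {d d' : ℕ} (hT : DiamLE G d T) (hT' : DiamLE G d' T')
    {a b : V} (ha : a ∈ T) (hb : b ∈ T') (hab : G.Adj a b) : DiamLE G (d + 1 + d') (T ∪ T') := by
  have h1 : within G (T : Set V) ≤ within G ((T ∪ T' : Finset V) : Set V) :=
    within_mono G (by simp)
  have h2 : within G (T' : Set V) ≤ within G ((T ∪ T' : Finset V) : Set V) :=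
    within_mono G (by simp)
  have hadj : (within G ((T ∪ T' : Finset V) : Set V)).Adj a b := ⟨hab, by simp [ha], by simp [hb]⟩
  have key : ∀ x ∈ T, ∀ y ∈ T', Near (within G ((T ∪ T' : Finset V) : Set V)) (d + 1 + d') x y :=
    fun x hx y hy => (((hT x hx a ha).mono h1 le_rfl).trans (Near.of_adj hadj)).trans
      ((hT' b hb y hy).mono h2 le_rfl)
  intro x hx y hy
  rcases Finset.mem_union.1 hx with hx | hx <;> rcases Finset.mem_union.1 hy with hy | hy
  · exact (hT x hx y hy).mono h1 (by omega)
  · exact key x hx y hy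
  · exact (key y hy x hx).symm
  · exact (hT' x hx y hy).mono h2 (by omega)

end Rooted

/-! ### Division into connected cells around cores -/

section Cells

variable {V : Type u} [Fintype V]

/-- A division of most of the graph outside `U` into connected cells with cores `P i` of size `s`.
Outside the cores and the exceptional set `Z`, the components (labelled by `c`) are small. -/
structure CellDecomposition (H : SimpleGraph V) (U : Finset V) (s d : ℕ) (ι : Type u) where
  P : ι → Finset V
  cell : V → Option ι
  Z : Finset V
  c : V → V
  card_core : ∀ i, (P i).card = s
  cell_core : ∀ i, ∀ x ∈ P i, cell x = some i
  notMem : ∀ x, cell x ≠ none → x ∉ U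
  label_eq : ∀ x y, x ∉ U → y ∉ U → x ∉ Z → y ∉ Z → (∀ i, x ∉ P i) → (∀ i, y ∉ P i) →
    H.Adj x y → c x = c y ∧ cell x = cell y
  card_label : ∀ (b : V) (S : Finset V),
    (∀ x ∈ S, x ∉ U ∧ x ∉ Z ∧ (∀ i, x ∉ P i) ∧ c x = b) → S.card ≤ s
  not_adj : ∀ x, x ∉ U → x ∉ Z → cell x = none → ∀ i, ∀ y ∈ P i, ¬ H.Adj x y
  exists_core : ∀ i x, cell x = some i → ∃ T : Finset V, (∀ y ∈ T, cell y = some i) ∧ x ∈ T ∧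
    P i ⊆ T ∧ T.card ≤ 2 * s ∧ DiamLE H d T

/-- A maximal family of disjoint rooted sets of size `s` outside `U`. -/
theorem exists_maximal_packing (H : SimpleGraph V) (U : Finset V) {s ρ : ℕ} (hs : 1 ≤ s) :
    ∃ Ps : Finset (Finset V), (∀ P ∈ Ps, P.card = s ∧ Disjoint P U ∧ ∃ z, IsRooted H ρ P z) ∧
      (∀ P ∈ Ps, ∀ Q ∈ Ps, P ≠ Q → Disjoint P Q) ∧
      ∀ P : Finset V, P.card = s → Disjoint P U → (∃ z, IsRooted H ρ P z) →
        ∃ Q ∈ Ps, ¬ Disjoint P Q := by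
  let S : Set (Finset (Finset V)) := {Ps |
    (∀ P ∈ Ps, P.card = s ∧ Disjoint P U ∧ ∃ z, IsRooted H ρ P z) ∧
      (∀ P ∈ Ps, ∀ Q ∈ Ps, P ≠ Q → Disjoint P Q)}
  obtain ⟨Ps, hPs⟩ := (Set.toFinite S).exists_maximal ⟨∅, by simp [S]⟩
  refine ⟨Ps, hPs.prop.1, hPs.prop.2, fun P hP hPU hz => ?_⟩
  by_contra! hcon
  have hmem : insert P Ps ∈ S := by
    refine ⟨fun Q hQ => ?_, fun Q hQ Q' hQ' hne => ?_⟩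
    · rcases Finset.mem_insert.1 hQ with rfl | hQ
      · exact ⟨hP, hPU, hz⟩
      · exact hPs.prop.1 Q hQ
    · rcases Finset.mem_insert.1 hQ with h1 | h1 <;> rcases Finset.mem_insert.1 hQ' with h2 | h2
      · exact absurd (h1.trans h2.symm) hne
      · exact h1 ▸ hcon _ h2
      · exact h2 ▸ (hcon _ h1).symm
      · exact hPs.prop.2 Q h1 Q' h2 hne
  have hPin : P ∈ Ps := hPs.le_of_ge hmem (Finset.subset_insert P Ps) (Finset.mem_insert_self P Ps)
  have := hcon P hPin
  rw [disjoint_self, Finset.bot_eq_empty] at this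
  subst this
  simp at hP
  omega

/-- The cores are a maximal packing of trees with `s` vertices and height at most ρ, and the rest is
carved with unit weights. A component of the carving is again spanned by a tree of height at most ρ,
so by maximality it has at most `s` vertices. Each component next to a core joins the cell of one
such core; core and component together have at most `2 * s` vertices and diameter at most 2ρ + 1 +
2ρ. -/
theorem exists_cellDecomposition (H : SimpleGraph V) (U : Finset V) {s ρ : ℕ} {η : ℝ} (hs : 1 ≤ s)
    (hη : 0 < η) (hρ : (Fintype.card V : ℝ) < (1 + η) ^ ρ) :
    ∃ (ι : Type u) (_ : Fintype ι) (D : CellDecomposition H U s (4 * ρ + 1) ι),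
      (D.Z.card : ℝ) ≤ η * Fintype.card V := by
  obtain ⟨Ps, hPs, hdisj, hmax⟩ := exists_maximal_packing H U (ρ := ρ) hs
  obtain ⟨A, h, c, hAR, hA, hc, hadj⟩ := exists_carving H (fun _ => 1) (fun _ => le_rfl) hη
    (n := Fintype.card V) (by simp) hρ (U ∪ Ps.biUnion id)ᶜ
  have hAmem : ∀ x, x ∈ A → x ∉ U ∧ ∀ P ∈ Ps, x ∉ P := by
    intro x hx
    have := hAR hx
    simp only [Finset.mem_compl, Finset.mem_union, Finset.mem_biUnion, id, not_or, not_exists,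
      not_and] at this
    exact this
  -- `K z` is the component of the carving with centre `z`.
  let K : V → Finset V := fun z => A.filter (fun x => c x = z)
  have hKroot : ∀ x ∈ A, IsRooted H ρ (K (c x)) (c x) := by
    intro x hx
    refine ⟨Finset.mem_filter.2 ⟨(hc x hx).2.1, (hc x hx).2.2.1⟩, h, fun y hy => ?_⟩
    obtain ⟨hyA, hyc⟩ := Finset.mem_filter.1 hy
    refine ⟨(hc y hyA).1, ?_⟩
    rcases (hc y hyA).2.2.2 with h1 | ⟨w, hw, hyw, hwc, hwh⟩
    · exact Or.inl (h1.trans hyc)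
    · exact Or.inr ⟨w, Finset.mem_filter.2 ⟨hw, hwc.trans hyc⟩, hyw, hwh⟩
  have hKcard : ∀ z, (K z).card ≤ s := by
    intro z
    by_contra! hcon
    obtain ⟨x, hx⟩ := Finset.card_pos.1 (show 0 < (K z).card by omega)
    obtain ⟨hxA, hxc⟩ := Finset.mem_filter.1 hx
    have hr := hKroot x hxA
    rw [hxc] at hr
    obtain ⟨Q, hQ, hQs, hQr⟩ := hr.exists_subset_card_eq hs hcon.le
    obtain ⟨P, hP, hPQ⟩ := hmax Q hQs (Finset.disjoint_left.2 fun v hv =>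
      (hAmem v (Finset.mem_filter.1 (hQ hv)).1).1) ⟨_, hQr⟩
    exact hPQ (Finset.disjoint_left.2 fun v hv => (hAmem v (Finset.mem_filter.1 (hQ hv)).1).2 P hP)
  let asg : V → Option {P // P ∈ Ps} := fun z =>
    if hz : ∃ i : {P // P ∈ Ps}, ∃ k ∈ K z, ∃ p ∈ i.1, H.Adj k p then some hz.choose else none
  have hasg : ∀ z i, asg z = some i → ∃ k ∈ K z, ∃ p ∈ i.1, H.Adj k p := by
    intro z i hz
    by_cases hz' : ∃ i : {P // P ∈ Ps}, ∃ k ∈ K z, ∃ p ∈ i.1, H.Adj k p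
    · simp only [asg, hz', dif_pos, Option.some.injEq] at hz
      exact hz ▸ hz'.choose_spec
    · simp only [asg, dif_neg hz', reduceCtorEq] at hz
  have hasg' : ∀ z, asg z = none → ∀ i : {P // P ∈ Ps}, ∀ k ∈ K z, ∀ p ∈ i.1, ¬ H.Adj k p := by
    intro z hz i k hk p hp hkp
    have hz' : ∃ i : {P // P ∈ Ps}, ∃ k ∈ K z, ∃ p ∈ i.1, H.Adj k p := ⟨i, k, hk, p, hp, hkp⟩
    simp only [asg, dif_pos hz', reduceCtorEq] at hz
  let cell : V → Option {P // P ∈ Ps} := fun x =>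
    if hx : ∃ i : {P // P ∈ Ps}, x ∈ i.1 then some hx.choose else if x ∈ A then asg (c x) else none
  have hcell1 : ∀ i : {P // P ∈ Ps}, ∀ x ∈ i.1, cell x = some i := by
    intro i x hx
    have hx' : ∃ i : {P // P ∈ Ps}, x ∈ i.1 := ⟨i, hx⟩
    simp only [cell, hx', dif_pos, Option.some.injEq]
    by_contra hne
    exact Finset.disjoint_left.1 (hdisj _ hx'.choose.2 _ i.2 (fun h' => hne (Subtype.ext h')))
      hx'.choose_spec hx
  have hcell2 : ∀ x, x ∈ A → cell x = asg (c x) := by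
    intro x hx
    have hx' : ¬ ∃ i : {P // P ∈ Ps}, x ∈ i.1 := fun ⟨i, hi⟩ => (hAmem x hx).2 _ i.2 hi
    simp only [cell, dif_neg hx', if_pos hx]
  have hcell3 : ∀ x, cell x ≠ none → x ∈ A ∨ ∃ i : {P // P ∈ Ps}, x ∈ i.1 := by
    intro x hx
    by_contra! hcon
    refine hx ?_
    have hx' : ¬ ∃ i : {P // P ∈ Ps}, x ∈ i.1 := fun ⟨i, hi⟩ => hcon.2 i hi
    simp only [cell, dif_neg hx', if_neg hcon.1]
  have hZ : ∀ x, x ∉ U → x ∉ (U ∪ Ps.biUnion id)ᶜ \ A → (∀ i : {P // P ∈ Ps}, x ∉ i.1) → x ∈ A := by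
    intro x hxU hxZ hxP
    by_contra hxA
    refine hxZ ?_
    simp only [Finset.mem_sdiff, Finset.mem_compl, Finset.mem_union, Finset.mem_biUnion, id, not_or,
      not_exists, not_and]
    exact ⟨⟨hxU, fun P hP => hxP ⟨P, hP⟩⟩, hxA⟩
  refine ⟨{P // P ∈ Ps}, inferInstance, ⟨fun i => i.1, cell, (U ∪ Ps.biUnion id)ᶜ \ A, c,
    fun i => (hPs _ i.2).1, hcell1, ?_, ?_, ?_, ?_, ?_⟩, ?_⟩
  · intro x hx
    rcases hcell3 x hx with h1 | ⟨i, hi⟩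
    · exact (hAmem x h1).1
    · exact Finset.disjoint_left.1 (hPs _ i.2).2.1 hi
  · intro x y hxU hyU hxZ hyZ hxP hyP hxy
    have hx := hZ x hxU hxZ hxP
    have hy := hZ y hyU hyZ hyP
    have := hadj x hx y hy hxy
    exact ⟨this, by rw [hcell2 x hx, hcell2 y hy, this]⟩
  · intro b S hS
    refine (Finset.card_le_card fun x hx => ?_).trans (hKcard b)
    obtain ⟨hxU, hxZ, hxP, hxb⟩ := hS x hx
    exact Finset.mem_filter.2 ⟨hZ x hxU hxZ hxP, hxb⟩
  · intro x hxU hxZ hxn i y hy hxy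
    have hxP : ∀ i : {P // P ∈ Ps}, x ∉ i.1 := by
      intro i hi
      rw [hcell1 i x hi] at hxn
      cases hxn
    have hxA := hZ x hxU hxZ hxP
    rw [hcell2 x hxA] at hxn
    exact hasg' _ hxn i x (Finset.mem_filter.2 ⟨hxA, rfl⟩) y hy hxy
  · intro i x hx
    obtain ⟨z, hz⟩ := (hPs _ i.2).2.2
    rcases hcell3 x (by rw [hx]; simp) with hxA | ⟨j, hj⟩
    · rw [hcell2 x hxA] at hx
      obtain ⟨k, hk, p, hp, hkp⟩ := hasg _ _ hx
      refine ⟨i.1 ∪ K (c x), ?_, ?_, Finset.subset_union_left, ?_, ?_⟩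
      · intro y hy
        rcases Finset.mem_union.1 hy with hy | hy
        · exact hcell1 i y hy
        · obtain ⟨hyA, hyc⟩ := Finset.mem_filter.1 hy
          rw [hcell2 y hyA, hyc, hx]
      · exact Finset.mem_union_right _ (Finset.mem_filter.2 ⟨hxA, rfl⟩)
      · have h1 := Finset.card_union_le i.1 (K (c x))
        have h2 := hKcard (c x)
        have h3 := (hPs _ i.2).1
        omega
      · have h1 := hz.diamLE.union (hKroot x hxA).diamLE hp hk hkp.symm
        intro a ha b hb
        exact (h1 a ha b hb).mono le_rfl (by omega)
    · have : j = i := by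
        have := hcell1 j x hj
        rw [hx] at this
        exact (Option.some.inj this).symm
      subst this
      refine ⟨j.1, hcell1 j, hj, subset_rfl, by rw [(hPs _ j.2).1]; omega, ?_⟩
      intro a ha b hb
      exact (hz.diamLE a ha b hb).mono le_rfl (by omega)
  · have h1 : ((A.card : ℕ) : ℝ) ≤ Fintype.card V := by exact_mod_cast Finset.card_le_univ A
    simp only [Finset.sum_const, smul_eq_mul, mul_one] at hA
    exact hA.trans (mul_le_mul_of_nonneg_left h1 hη.le)

end Cells

/-! ### Short cycles from edges between cells -/

section Dumbbells

variable {V : Type u}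

/-- The cycle `C`, with vertex set `D`, meets each of the disjoint sets `T₁` and `T₂`, which have
small diameter and at least `s` vertices. -/
structure IsDumbbell (H : SimpleGraph V) (s d k : ℕ) (C : H.Subgraph) (D T₁ T₂ : Finset V) :
    Prop where
  cycle : IsCycleSubgraph C
  verts : (D : Set V) = C.verts
  card_cycle : D.card ≤ k
  disjoint : Disjoint T₁ T₂
  diam₁ : DiamLE H d T₁
  diam₂ : DiamLE H d T₂
  meets₁ : ∃ a ∈ D, a ∈ T₁
  meets₂ : ∃ a ∈ D, a ∈ T₂
  le_card₁ : s ≤ T₁.card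
  le_card₂ : s ≤ T₂.card
  card_le₁ : T₁.card ≤ 2 * s
  card_le₂ : T₂.card ≤ 2 * s

theorem IsDumbbell.swap {H : SimpleGraph V} {s d k : ℕ} {C : H.Subgraph} {D T₁ T₂ : Finset V}
    (h : IsDumbbell H s d k C D T₁ T₂) : IsDumbbell H s d k C D T₂ T₁ :=
  ⟨h.cycle, h.verts, h.card_cycle, h.disjoint.symm, h.diam₂, h.diam₁, h.meets₂, h.meets₁,
    h.le_card₂, h.le_card₁, h.card_le₂, h.card_le₁⟩

/-- If the ends of an edge are joined by a path that avoids it, then the edge is in a cycle. -/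
theorem exists_cycle_of_near {H T : SimpleGraph V} (hT : T ≤ H) {k : ℕ} {x y : V}
    (hxy : H.Adj x y) (hnot : ¬ T.Adj x y) (hnear : Near T k x y) :
    ∃ (C : H.Subgraph) (D : Finset V) (w : T.Walk x y), IsCycleSubgraph C ∧ (D : Set V) = C.verts ∧
      D.card ≤ k + 1 ∧ x ∈ D ∧ y ∈ D ∧ ∀ v ∈ D, v ∈ w.support := by
  obtain ⟨w, hw⟩ := hnear
  have hcyc : (SimpleGraph.Walk.cons hxy.symm (w.bypass.mapLe hT)).IsCycle := by
    rw [SimpleGraph.Walk.cons_isCycle_iff]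
    refine ⟨w.bypass_isPath.mapLe hT, fun hmem => hnot ?_⟩
    rw [SimpleGraph.Walk.edges_mapLe_eq_edges] at hmem
    exact (w.bypass.adj_of_mem_edges hmem).symm
  have hverts : ((w.bypass.support.toFinset : Finset V) : Set V) =
      (SimpleGraph.Walk.cons hxy.symm (w.bypass.mapLe hT)).toSubgraph.verts := by
    ext v
    rw [SimpleGraph.Walk.mem_verts_toSubgraph]
    simp only [List.coe_toFinset, Set.mem_ofPred_eq, SimpleGraph.Walk.support_cons, List.mem_cons,
      SimpleGraph.Walk.support_mapLe_eq_support]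
    constructor
    · exact Or.inr
    · rintro (rfl | h)
      · simp
      · exact h
  refine ⟨_, _, w, ⟨_, _, hcyc, rfl⟩, hverts, ?_, by simp, by simp, fun v hv =>
    w.support_bypass_subset_support (by simpa using hv)⟩
  refine (List.toFinset_card_le _).trans ?_
  rw [SimpleGraph.Walk.length_support]
  have := w.length_bypass_le_length
  omega

namespace CellDecomposition

variable {H : SimpleGraph V} {U : Finset V} {s d : ℕ} {ι : Type u}

/-- The graph of the adjacent cells. -/
def quotient (D : CellDecomposition H U s d ι) : SimpleGraph ι where
  Adj i j := i ≠ j ∧ ∃ a b, D.cell a = some i ∧ D.cell b = some j ∧ H.Adj a b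
  symm := ⟨fun _ _ ⟨h, a, b, ha, hb, hab⟩ => ⟨h.symm, b, a, hb, ha, hab.symm⟩⟩
  loopless := ⟨fun _ h => h.1 rfl⟩

/-- The core lies in both sets supplied by `exists_core`, so one walk of length at most `d` leads to
it from each vertex. -/
theorem near_of_cell_eq (D : CellDecomposition H U s d ι) (hs : 1 ≤ s) {i : ι} {x y : V}
    (hx : D.cell x = some i) (hy : D.cell y = some i) :
    Near (within H {v | D.cell v = some i}) (2 * d) x y := by
  obtain ⟨T, hT, hxT, hPT, -, hTd⟩ := D.exists_core i x hx
  obtain ⟨T', hT', hyT', hPT', -, hTd'⟩ := D.exists_core i y hy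
  obtain ⟨p, hp⟩ := Finset.card_pos.1 (show 0 < (D.P i).card by rw [D.card_core]; omega)
  rw [two_mul]
  exact ((hTd x hxT p (hPT hp)).mono (within_mono H hT) le_rfl).trans
    ((hTd' p (hPT' hp) y hyT').mono (within_mono H hT') le_rfl)

/-- The edges of `H` that lie inside a cell or touch `Z`. -/
def inner (D : CellDecomposition H U s d ι) (Z : Finset V) : SimpleGraph V where
  Adj x y := H.Adj x y ∧ D.cell x ≠ none ∧ D.cell y ≠ none ∧
    (D.cell x = D.cell y ∨ x ∈ Z ∨ y ∈ Z)
  symm := ⟨fun _ _ ⟨h, hx, hy, hxy⟩ => ⟨h.symm, hy, hx, by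
    rcases hxy with h | h | h
    · exact Or.inl h.symm
    · exact Or.inr (Or.inr h)
    · exact Or.inr (Or.inl h)⟩⟩
  loopless := ⟨fun _ h => h.1.ne rfl⟩

/-- The edge `xy` joins different cells and misses `Z`, so it is not in `D.inner Z`, and a walk
there closes it to a cycle. The sets from `exists_core` around `x` and `y` are disjoint because the
cells are, and everything lies in cells, hence outside `U`. -/
theorem exists_dumbbell_of_near (D : CellDecomposition H U s d ι) {Z : Finset V}
    {i j : ι} {x y : V} {k : ℕ} (hij : i ≠ j) (hx : D.cell x = some i) (hy : D.cell y = some j)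
    (hxZ : x ∉ Z) (hyZ : y ∉ Z) (hxy : H.Adj x y) (hnear : Near (D.inner Z) k x y) :
    ∃ C D' T₁ T₂, IsDumbbell H s d (k + 1) C D' T₁ T₂ ∧ Disjoint (D' ∪ T₁ ∪ T₂) U := by
  obtain ⟨C, D', w, hC, hD', hcard, hxD, hyD, hw⟩ := exists_cycle_of_near
    (T := D.inner Z) (fun _ _ h => h.1) hxy
    (by
      rintro ⟨-, -, -, h | h | h⟩
      · rw [hx, hy] at h; exact hij (Option.some.inj h)
      · exact hxZ h
      · exact hyZ h) hnear
  obtain ⟨T, hT, hxT, hPT, hTc, hTd⟩ := D.exists_core i x hx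
  obtain ⟨T', hT', hyT', hPT', hTc', hTd'⟩ := D.exists_core j y hy
  have hwcell : ∀ v ∈ w.support, D.cell v ≠ none := by
    have key : ∀ {a b : V} (p : (D.inner Z).Walk a b), D.cell a ≠ none →
        ∀ v ∈ p.support, D.cell v ≠ none := by
      intro a b p ha
      induction p with
      | nil => simpa using ha
      | cons h p ih =>
        intro v hv
        rw [SimpleGraph.Walk.support_cons, List.mem_cons] at hv
        rcases hv with rfl | hv
        · exact ha
        · exact ih h.2.2.1 v hv
    exact key w (by simp [hx])
  refine ⟨C, D', T, T', ⟨hC, hD', hcard, ?_, hTd, hTd', ⟨x, hxD, hxT⟩, ⟨y, hyD, hyT'⟩, ?_, ?_, hTc,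
    hTc'⟩, ?_⟩
  · refine Finset.disjoint_left.2 fun v hv hv' => hij ?_
    have := hT v hv
    rw [hT' v hv'] at this
    exact (Option.some.inj this).symm
  · rw [← D.card_core i]; exact Finset.card_le_card hPT
  · rw [← D.card_core j]; exact Finset.card_le_card hPT'
  · refine Finset.disjoint_left.2 fun v hv => D.notMem v ?_
    rcases Finset.mem_union.1 hv with hv | hv
    · rcases Finset.mem_union.1 hv with hv | hv
      · exact hwcell v (hw v hv)
      · rw [hT v hv]; simp
    · rw [hT' v hv]; simp

end CellDecomposition

end Dumbbells

/-! ### Existence of dumbbells outside a small set -/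

section DumbbellExistence

variable {V : Type u} [Fintype V] {H : SimpleGraph V} {U : Finset V} {s d : ℕ} {ι : Type u}

namespace CellDecomposition

/-- The set of vertices of the cell `i`. -/
noncomputable def members (D : CellDecomposition H U s d ι) (i : ι) : Finset V :=
  Finset.univ.filter (fun x => D.cell x = some i)

theorem mem_members {D : CellDecomposition H U s d ι} {i : ι} {x : V} :
    x ∈ D.members i ↔ D.cell x = some i := by simp [members]

theorem core_subset_members (D : CellDecomposition H U s d ι) (i : ι) : D.P i ⊆ D.members i :=
  fun x hx => mem_members.2 (D.cell_core i x hx)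

theorem le_card_members (D : CellDecomposition H U s d ι) (i : ι) : s ≤ (D.members i).card := by
  exact (D.card_core i).ge.trans (Finset.card_le_card (D.core_subset_members i))

theorem card_biUnion_members (D : CellDecomposition H U s d ι) (S : Finset ι) :
    (S.biUnion D.members).card = ∑ i ∈ S, (D.members i).card := by
  refine Finset.card_biUnion fun i _ j _ hij => Finset.disjoint_left.2 fun x hx hx' => hij ?_
  rw [mem_members] at hx hx'
  rw [hx] at hx'
  exact Option.some.inj hx'

theorem sum_card_members_le [Fintype ι] (D : CellDecomposition H U s d ι) :
    ∑ i, (D.members i).card ≤ Fintype.card V := by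
  rw [← D.card_biUnion_members]
  exact Finset.card_le_univ _

theorem card_mul_le [Fintype ι] (D : CellDecomposition H U s d ι) :
    Fintype.card ι * s ≤ Fintype.card V := by
  refine le_trans ?_ D.sum_card_members_le
  rw [← smul_eq_mul, ← Finset.card_univ]
  exact Finset.card_nsmul_le_sum _ _ _ fun i _ => D.le_card_members i

/-- Apart from few vertices, any two adjacent cells are joined by short walks inside cells and
through a small set `Z` of vertices. -/
theorem exists_connectors [Fintype ι] (D : CellDecomposition H U s d ι) (hs : 1 ≤ s) [Nonempty V] {ρ : ℕ}
    {η : ℝ} (hη : 0 < η) (hρ : (Fintype.card V : ℝ) < (1 + η) ^ ρ) :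
    ∃ Z W : Finset V, (W.card : ℝ) ≤ η * Fintype.card V ∧ Z.card ≤ Fintype.card ι ∧
      ∀ i j x y, D.cell x = some i → D.cell y = some j → x ∉ W → y ∉ W → i ≠ j → H.Adj x y →
        Near (D.inner Z) (2 * ((2 * d + 1) * ρ + 2 * d)) x y := by
  obtain ⟨A, h, c, -, hA, hc, hadj⟩ := exists_carving D.quotient (fun i => (D.members i).card)
    (fun i => hs.trans (D.le_card_members i)) hη D.sum_card_members_le hρ Finset.univ
  -- `q i` is the end in cell `i` of an edge to its parent cell, and is arbitrary for centres and
  -- deleted cells. These vertices form the connecting set, one per cell.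
  have hq : ∀ i, ∃ a : V, i ∈ A → i ≠ c i → ∃ j ∈ A, ∃ b, c j = c i ∧ h j < h i ∧
      D.cell a = some i ∧ D.cell b = some j ∧ H.Adj a b := by
    intro i
    by_cases hi : i ∈ A ∧ i ≠ c i
    · rcases (hc i hi.1).2.2.2 with h1 | ⟨j, hj, ⟨-, a, b, ha, hb, hab⟩, hjc, hjh⟩
      · exact absurd h1 hi.2
      · exact ⟨a, fun _ _ => ⟨j, hj, b, hjc, hjh, ha, hb, hab⟩⟩
    · exact ⟨Classical.arbitrary V, fun h1 h2 => absurd ⟨h1, h2⟩ hi⟩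
  choose q hq using hq
  refine ⟨Finset.univ.image q, (Finset.univ \ A).biUnion D.members, ?_, Finset.card_image_le, ?_⟩
  · rw [D.card_biUnion_members]
    refine hA.trans (mul_le_mul_of_nonneg_left ?_ hη.le)
    exact_mod_cast (Finset.sum_le_sum_of_subset (Finset.subset_univ A)).trans D.sum_card_members_le
  · set T := D.inner (Finset.univ.image q) with hT
    have hcellnear : ∀ i a b, D.cell a = some i → D.cell b = some i → Near T (2 * d) a b := by
      intro i a b ha hb
      refine (D.near_of_cell_eq hs ha hb).mono (fun v w hvw => ?_) le_rfl
      obtain ⟨h1, h2, h3⟩ := hvw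
      simp only [Set.mem_ofPred_eq] at h2 h3
      exact ⟨h1, by simp [h2], by simp [h3], Or.inl (h2.trans h3.symm)⟩
    -- Each level towards the central cell costs at most `2 * d` steps inside a cell and one
    -- connecting edge.
    have key : ∀ k, ∀ i ∈ A, h i ≤ k → ∀ a z, D.cell a = some i → D.cell z = some (c i) →
        Near T ((2 * d + 1) * k + 2 * d) a z := by
      intro k
      induction k with
      | zero =>
        intro i hi hk a z ha hz
        by_cases hic : i = c i
        · rw [← hic] at hz
          exact (hcellnear i a z ha hz).mono le_rfl (by omega)
        · obtain ⟨j, -, b, -, hjh, -⟩ := hq i hi hic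
          omega
      | succ k ih =>
        intro i hi hk a z ha hz
        by_cases hic : i = c i
        · rw [← hic] at hz
          exact (hcellnear i a z ha hz).mono le_rfl (by omega)
        · obtain ⟨j, hj, b, hjc, hjh, hqi, hb, hqb⟩ := hq i hi hic
          have h1 : Near T 1 (q i) b := Near.of_adj
            ⟨hqb, by simp [hqi], by simp [hb], Or.inr (Or.inl (by simp))⟩
          have h2 := ih j hj (by omega) b z hb (by rw [hjc]; exact hz)
          refine (((hcellnear i a (q i) ha hqi).trans h1).trans h2).mono le_rfl ?_
          ring_nf
          omega
    intro i j x y hx hy hxW hyW hij hxy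
    have hmem : ∀ i x, D.cell x = some i → x ∉ (Finset.univ \ A).biUnion D.members → i ∈ A := by
      intro i x hx hxW
      by_contra hiA
      exact hxW (Finset.mem_biUnion.2 ⟨i, by simp [hiA], mem_members.2 hx⟩)
    have hi := hmem i x hx hxW
    have hj := hmem j y hy hyW
    have hcij : c i = c j := hadj i hi j hj ⟨hij, x, y, hx, hy, hxy⟩
    obtain ⟨z, hz⟩ := Finset.card_pos.1
      (show 0 < (D.members (c i)).card from hs.trans (D.le_card_members _))
    rw [mem_members] at hz
    have h1 := key ρ i hi (hc i hi).1 x z hx hz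
    have h2 := key ρ j hj (hc j hj).1 y z hy (by rw [← hcij]; exact hz)
    exact (h1.trans h2.symm).mono le_rfl (by omega)

end CellDecomposition

/-- After deleting a small set, an expander still has a short cycle that meets two disjoint
connected sets of prescribed size. -/
theorem exists_dumbbell {δ : ℝ} (hH : HasExpansion H δ) (hδ : 0 < δ) (hδ1 : δ ≤ 1)
    (hn : 32 ≤ Fintype.card V) {ρ : ℕ}
    (hρ : (Fintype.card V : ℝ) < (1 + δ / 100) ^ ρ) (hs : 100 ≤ δ * s)
    (hsn : 800 * (s : ℝ) ≤ δ * Fintype.card V) (hU : 100 * (U.card : ℝ) ≤ δ * Fintype.card V) :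
    ∃ C D T₁ T₂, IsDumbbell H s (4 * ρ + 1)
      (2 * ((2 * (4 * ρ + 1) + 1) * ρ + 2 * (4 * ρ + 1)) + 1) C D T₁ T₂ ∧
      Disjoint (D ∪ T₁ ∪ T₂) U := by
  by_contra hcon
  set n := Fintype.card V with hn'
  have hs1 : 1 ≤ s := by
    rcases Nat.eq_zero_or_pos s with h0 | h0
    · rw [h0] at hs; norm_num at hs
    · exact h0
  have hn0 : (0 : ℝ) < n := by
    have : (32 : ℝ) ≤ n := by exact_mod_cast hn
    linarith
  have : Nonempty V := Fintype.card_pos_iff.1 (by omega)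
  have hη : 0 < δ / 100 := by positivity
  have hsn' : 8 * s ≤ n := by
    have : 8 * (s : ℝ) ≤ n := by nlinarith [(Nat.cast_nonneg s : (0 : ℝ) ≤ s)]
    exact_mod_cast this
  obtain ⟨κ, hκ, D, hZ⟩ := exists_cellDecomposition H U hs1 hη hρ
  obtain ⟨Q, W, hW, hQ, hnear⟩ := D.exists_connectors hs1 hη hρ
  -- Cells with more than n/8 vertices would be too large as components. There are at most 8 of
  -- them, so their cores can be deleted, which breaks them into components of at most `s` vertices.
  let big : Finset κ := Finset.univ.filter (fun i => n < 8 * (D.members i).card)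
  have hbig : big.card ≤ 8 := by
    have h1 : big.card * n ≤ ∑ i ∈ big, 8 * (D.members i).card := by
      rw [← smul_eq_mul]
      exact Finset.card_nsmul_le_sum _ _ _ fun i hi => (Finset.mem_filter.1 hi).2.le
    rw [← Finset.mul_sum] at h1
    have h2 : ∑ i ∈ big, (D.members i).card ≤ n :=
      (Finset.sum_le_sum_of_subset (Finset.subset_univ _)).trans D.sum_card_members_le
    have h3 : big.card * n ≤ 8 * n := h1.trans (by omega)
    exact Nat.le_of_mul_le_mul_right h3 (by omega)
  let B : Finset V := U ∪ D.Z ∪ W ∪ Q ∪ big.biUnion D.P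
  -- Each of the five parts of `B` has at most δn/100 vertices. For `Q` this holds because there are
  -- at most n/s cells and δs ≥ 100.
  have hBcard : 4 * (B.card : ℝ) < δ * n := by
    have h1 : B.card ≤ U.card + D.Z.card + W.card + Q.card + big.card * s := by
      refine (Finset.card_union_le _ _).trans (add_le_add ?_
        (Finset.card_biUnion_le_card_mul _ _ _ fun i _ => (D.card_core i).le))
      refine (Finset.card_union_le _ _).trans (add_le_add_left ?_ _)
      refine (Finset.card_union_le _ _).trans (add_le_add_left ?_ _)
      exact Finset.card_union_le _ _
    have h2 : (B.card : ℝ) ≤ U.card + D.Z.card + W.card + Q.card + big.card * s := by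
      exact_mod_cast h1
    have h3 : (Q.card : ℝ) * s ≤ n := by
      have := (Nat.mul_le_mul_right s hQ).trans D.card_mul_le
      exact_mod_cast this
    have h4 : (big.card : ℝ) * s ≤ 8 * s :=
      mul_le_mul_of_nonneg_right (by exact_mod_cast hbig) (Nat.cast_nonneg _)
    have h5 : 100 * (Q.card : ℝ) ≤ δ * n := by
      have h0 : (0 : ℝ) ≤ Q.card := Nat.cast_nonneg _
      calc 100 * (Q.card : ℝ) ≤ (δ * s) * Q.card := mul_le_mul_of_nonneg_right hs h0
        _ = δ * (Q.card * s) := by ring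
        _ ≤ δ * n := mul_le_mul_of_nonneg_left h3 hδ.le
    have h6 : 0 < δ * n := by positivity
    linarith
  have hB : ∀ x, x ∉ B → x ∉ U ∧ x ∉ D.Z ∧ x ∉ W ∧ x ∉ Q ∧ ∀ i ∈ big, x ∉ D.P i := by
    intro x hx
    simpa only [B, Finset.mem_union, Finset.mem_biUnion, not_or, not_exists, not_and,
      and_assoc] using hx
  -- A small cell is one class; in big cells and outside all cells the classes are the carved
  -- components.
  let f : V → κ ⊕ V := fun x => match D.cell x with
    | some i => if i ∈ big then Sum.inr (D.c x) else Sum.inl i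
    | none => Sum.inr (D.c x)
  have hcore : ∀ x i, x ∉ B → (∀ j, D.cell x = some j → j ∈ big) → x ∉ D.P i := by
    intro x i hx h1 hxi
    exact (hB x hx).2.2.2.2 i (h1 i (D.cell_core i x hxi)) hxi
  refine false_of_small_components hH hδ hδ1 hn B f ?_ ?_ hBcard
  · intro x hx y hy hxy
    obtain ⟨hxU, hxZ, hxW, hxQ, hxb⟩ := hB x hx
    obtain ⟨hyU, hyZ, hyW, hyQ, hyb⟩ := hB y hy
    have hnone : ∀ x y, x ∉ B → y ∉ B → H.Adj x y → D.cell x = none →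
        D.c x = D.c y ∧ D.cell x = D.cell y := by
      intro x y hx hy hxy hcx
      refine D.label_eq x y (hB x hx).1 (hB y hy).1 (hB x hx).2.1 (hB y hy).2.1 ?_ ?_ hxy
      · intro i hi
        rw [D.cell_core i x hi] at hcx
        cases hcx
      · intro i hi
        exact D.not_adj x (hB x hx).1 (hB x hx).2.1 hcx i y hi hxy
    rcases hcx : D.cell x with _ | i
    · obtain ⟨h1, h2⟩ := hnone x y hx hy hxy hcx
      simp only [f, ← h2, hcx, h1]
    · rcases hcy : D.cell y with _ | j
      · obtain ⟨h1, h2⟩ := hnone y x hy hx hxy.symm hcy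
        rw [hcx, hcy] at h2
        cases h2
      · by_cases hij : i = j
        · subst hij
          by_cases hi : i ∈ big
          · have h1 := (D.label_eq x y hxU hyU hxZ hyZ
              (fun k => hcore x k hx fun j hj => by
                rw [hcx] at hj; exact Option.some.inj hj ▸ hi)
              (fun k => hcore y k hy fun j hj => by
                rw [hcy] at hj; exact Option.some.inj hj ▸ hi) hxy).1
            simp only [f, hcx, hcy, if_pos hi, h1]
          · simp only [f, hcx, hcy, if_neg hi]
        · exact absurd (D.exists_dumbbell_of_near hij hcx hcy hxQ hyQ hxy
            (hnear i j x y hcx hcy hxW hyW hij hxy)) hcon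
  · rintro (i | b) S hS
    · by_cases hi : i ∈ big
      · have h0 : S = ∅ := by
          refine Finset.eq_empty_of_forall_notMem fun x hxS => ?_
          have hx := (hS x hxS).2
          rcases hcx : D.cell x with _ | j
          · simp [f, hcx] at hx
          · by_cases hj : j ∈ big
            · simp [f, hcx, hj] at hx
            · simp only [f, hcx, hj, if_false, Sum.inl.injEq] at hx
              exact hj (hx ▸ hi)
        simp [h0]
      · have h1 : 8 * (D.members i).card ≤ n := by
          simpa [big] using hi
        refine le_trans (Nat.mul_le_mul_left 8 (Finset.card_le_card fun x hx => ?_)) h1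
        replace hx := (hS x hx).2
        rw [CellDecomposition.mem_members]
        rcases hcx : D.cell x with _ | j
        · simp [f, hcx] at hx
        · by_cases hj : j ∈ big
          · simp [f, hcx, hj] at hx
          · simp only [f, hcx, hj, if_false, Sum.inl.injEq] at hx
            rw [hx]
    · refine le_trans (Nat.mul_le_mul_left 8 (D.card_label b S fun x hx => ?_)) hsn'
      obtain ⟨hxB, hx⟩ := hS x hx
      have h1 : D.c x = b ∧ ∀ j, D.cell x = some j → j ∈ big := by
        rcases hcx : D.cell x with _ | j
        · simp only [f, hcx, Sum.inr.injEq] at hx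
          exact ⟨hx, fun j hj => by cases hj⟩
        · by_cases hj : j ∈ big
          · simp only [f, hcx, hj, if_true, Sum.inr.injEq] at hx
            exact ⟨hx, fun k hk => Option.some.inj hk ▸ hj⟩
          · simp [f, hcx, hj] at hx
      exact ⟨(hB x hxB).1, (hB x hxB).2.1, fun i => hcore x i hxB h1.2, h1.1⟩

end DumbbellExistence

/-! ### Dumbbells as gadgets -/

section Gadgets

variable {V : Type u}

/-- `K` and `T` are disjoint, and from `x ∈ K` one can pass through a cycle to every vertex of `T`
using few vertices of `K ∪ T`. -/
structure IsPassage (H : SimpleGraph V) (b s : ℕ) (x : V) (K T : Finset V) : Prop where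
  mem : x ∈ K
  card_le : K.card ≤ b
  le_card : s ≤ T.card
  disjoint : Disjoint K T
  exists_necklace : ∀ y ∈ T, ∃ S, Necklace H x y S 1 ∧ S ⊆ K ∪ T ∧ S.card ≤ b

/-- A gadget can be entered at any of its vertices and passed through a cycle. -/
def IsGadget (H : SimpleGraph V) (b s : ℕ) (W : Finset V) : Prop :=
  W.Nonempty ∧ ∀ x ∈ W, ∃ K T, K ⊆ W ∧ T ⊆ W ∧ IsPassage H b s x K T

variable {H : SimpleGraph V} {s d k : ℕ} {C : H.Subgraph} {D T₁ T₂ : Finset V}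

/-- Stopping at the first vertex of `D` makes the path meet the cycle only once, as consecutive
members of a necklace must. -/
theorem exists_path_to_cycle (hT : DiamLE H d T₁) (hm : ∃ a ∈ D, a ∈ T₁) {x : V} (hx : x ∈ T₁) :
    ∃ a ∈ D, a ∈ T₁ ∧ ∃ q : H.Walk x a, q.IsPath ∧ q.support.toFinset.card ≤ d + 1 ∧
      ∀ v ∈ q.support, v ∈ T₁ ∧ (v ∈ D → v = a) := by
  obtain ⟨a₀, ha₀, ha₀T⟩ := hm
  obtain ⟨w, hw⟩ := hT x hx a₀ ha₀T
  obtain ⟨a, ha, q, hq, hql, hqs⟩ := exists_path_first_hit (C := (D : Set V)) w ha₀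
  have hin : ∀ v ∈ q.support, v ∈ T₁ := fun v hv =>
    support_subset_of_within w hx v (hqs v hv).1
  refine ⟨a, ha, hin a (by simp), q.mapLe (within_le _ _), hq.mapLe _, ?_, fun v hv => ?_⟩
  · refine (List.toFinset_card_le _).trans ?_
    rw [SimpleGraph.Walk.length_support, SimpleGraph.Walk.length_map]
    omega
  · rw [SimpleGraph.Walk.support_mapLe_eq_support] at hv
    exact ⟨hin v hv, (hqs v hv).2⟩

/-- Go through `T₁` to the cycle, use the cycle, and leave through `T₂`. The set `K` is the entry
path together with `D`. The exit set `T₂ \ D` keeps `s` vertices because `T₂` has at least `s + k`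
and `D` at most `k`. -/
theorem IsDumbbell.exists_passage (h : IsDumbbell H (s + k) d k C D T₁ T₂) {x : V}
    (hx : x ∈ D ∪ T₁) (hx₂ : x ∉ T₂) :
    ∃ K T, K ⊆ D ∪ T₁ ∪ T₂ ∧ T ⊆ D ∪ T₁ ∪ T₂ ∧ IsPassage H (k + 2 * (d + 1)) s x K T := by
  obtain ⟨a, ha, q, hq, hqc, hqs⟩ : ∃ a ∈ D, ∃ q : H.Walk x a, q.IsPath ∧
      q.support.toFinset.card ≤ d + 1 ∧
      ∀ v ∈ q.support, (v ∈ T₁ ∧ v ∉ T₂ ∨ v = x) ∧ (v ∈ D → v = a) := by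
    by_cases hxD : x ∈ D
    · exact ⟨x, hxD, .nil, by simp, by simp, by simp⟩
    · have hxT : x ∈ T₁ := by simpa [hxD] using hx
      obtain ⟨a, ha, -, q, hq, hqc, hqs⟩ := exists_path_to_cycle h.diam₁ h.meets₁ hxT
      exact ⟨a, ha, q, hq, hqc, fun v hv =>
        ⟨Or.inl ⟨(hqs v hv).1, Finset.disjoint_left.1 h.disjoint (hqs v hv).1⟩, (hqs v hv).2⟩⟩
  have hqT : ∀ v ∈ q.support, v ∉ T₂ := by
    intro v hv
    rcases (hqs v hv).1 with h' | rfl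
    · exact h'.2
    · exact hx₂
  have hqW : ∀ v ∈ q.support, v ∈ D ∪ T₁ := by
    intro v hv
    rcases (hqs v hv).1 with h' | rfl
    · exact Finset.mem_union_right _ h'.1
    · exact hx
  have hDk := h.card_cycle
  refine ⟨q.support.toFinset ∪ D, T₂ \ D, ?_, ?_, ?_⟩
  · refine Finset.union_subset (fun v hv => ?_) fun v hv => by simp [hv]
    exact Finset.mem_union_left _ (hqW v (List.mem_toFinset.1 hv))
  · exact fun v hv => Finset.mem_union_right _ (Finset.mem_sdiff.1 hv).1
  · refine ⟨by simp, ?_, ?_, ?_, ?_⟩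
    · refine (Finset.card_union_le _ _).trans ?_
      omega
    · have := Finset.le_card_sdiff D T₂
      have := h.le_card₂
      omega
    · refine Finset.disjoint_left.2 fun v hv hv' => ?_
      obtain ⟨hvT, hvD⟩ := Finset.mem_sdiff.1 hv'
      rcases Finset.mem_union.1 hv with hv | hv
      · exact hqT v (List.mem_toFinset.1 hv) hvT
      · exact hvD hv
    · intro y hy
      obtain ⟨hyT, hyD⟩ := Finset.mem_sdiff.1 hy
      obtain ⟨e, he, heT, p, hp, hpc, hps⟩ := exists_path_to_cycle h.diam₂ h.meets₂ hyT
      have hea : e ≠ a := by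
        rintro rfl
        exact hqT e (by simp) heT
      have h1 : Necklace H x e (q.support.toFinset ∪ D) (0 + 1) := by
        refine (Necklace.of_isPath q hq).cycle C D h.cycle h.verts he hea ?_
        ext v
        simp only [Finset.mem_inter, List.mem_toFinset, Finset.mem_singleton]
        constructor
        · rintro ⟨hvD, hv⟩
          exact (hqs v hv).2 hvD
        · rintro rfl
          exact ⟨ha, by simp⟩
      have h2 := h1.append (Necklace.of_isPath p.reverse hp.reverse) (by
        ext v
        simp only [Finset.mem_inter, Finset.mem_union, List.mem_toFinset, Finset.mem_singleton,
          SimpleGraph.Walk.support_reverse, List.mem_reverse]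
        constructor
        · rintro ⟨hv | hv, hv'⟩
          · exact absurd (hps v hv').1 (hqT v hv)
          · exact (hps v hv').2 hv
        · rintro rfl
          exact ⟨Or.inr he, by simp⟩)
      refine ⟨_, h2, ?_, ?_⟩
      · intro v hv
        simp only [Finset.mem_union, List.mem_toFinset, Finset.mem_sdiff,
          SimpleGraph.Walk.support_reverse, List.mem_reverse] at hv ⊢
        rcases hv with hv | hv
        · exact Or.inl hv
        · by_cases hvD : v ∈ D
          · exact Or.inl (Or.inr hvD)
          · exact Or.inr ⟨(hps v hv).1, hvD⟩
      · refine (Finset.card_union_le _ _).trans ?_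
        have h3 := Finset.card_union_le q.support.toFinset D
        have h4 : p.reverse.support.toFinset.card = p.support.toFinset.card := by
          rw [SimpleGraph.Walk.support_reverse, List.toFinset_reverse]
        omega

/-- The two sides are interchangeable, so an entry in `T₂` is handled by swapping them. -/
theorem IsDumbbell.isGadget (h : IsDumbbell H (s + k) d k C D T₁ T₂) :
    IsGadget H (k + 2 * (d + 1)) s (D ∪ T₁ ∪ T₂) := by
  refine ⟨?_, fun x hx => ?_⟩
  · obtain ⟨a, ha, -⟩ := h.meets₁
    exact ⟨a, by simp [ha]⟩
  · by_cases hx₂ : x ∈ T₂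
    · have hx₁ : x ∉ T₁ := Finset.disjoint_right.1 h.disjoint hx₂
      have := h.swap.exists_passage (by simp [hx₂]) hx₁
      rwa [Finset.union_right_comm] at this
    · exact h.exists_passage (by simpa [hx₂] using hx) hx₂

theorem IsDumbbell.card_union_le (h : IsDumbbell H s d k C D T₁ T₂) :
    (D ∪ T₁ ∪ T₂).card ≤ k + 4 * s := by
  have h1 := Finset.card_union_le (D ∪ T₁) T₂
  have h2 := Finset.card_union_le D T₁
  have h3 := h.card_cycle
  have h4 := h.card_le₁
  have h5 := h.card_le₂
  omega

theorem IsGadget.le_card {b : ℕ} {W : Finset V} (h : IsGadget H b s W) : s ≤ W.card := by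
  obtain ⟨⟨x, hx⟩, h2⟩ := h
  obtain ⟨K, T, -, hT, hp⟩ := h2 x hx
  exact hp.le_card.trans (Finset.card_le_card hT)

end Gadgets

/-! ### Many disjoint gadgets -/

section GadgetFamilies

variable {V : Type u} [Fintype V] {H : SimpleGraph V}

/-- An expander contains many disjoint gadgets. -/
theorem exists_gadget_family {δ : ℝ} (hH : HasExpansion H δ) (hδ : 0 < δ) (hδ1 : δ ≤ 1)
    (hn : 32 ≤ Fintype.card V) {ρ k s : ℕ} (hρ : (Fintype.card V : ℝ) < (1 + δ / 100) ^ ρ)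
    (hk : k = 2 * ((2 * (4 * ρ + 1) + 1) * ρ + 2 * (4 * ρ + 1)) + 1)
    (hs : 100 ≤ δ * ((s + k : ℕ) : ℝ)) (hsn : 800 * ((s + k : ℕ) : ℝ) ≤ δ * Fintype.card V)
    (N : ℕ) (hN : 100 * (N * (k + 4 * (s + k)) : ℕ) ≤ δ * Fintype.card V) :
    ∃ Us : Finset (Finset V), Us.card = N ∧
      (∀ W ∈ Us, IsGadget H (k + 2 * (4 * ρ + 1 + 1)) s W ∧ W.card ≤ k + 4 * (s + k)) ∧
      ∀ W ∈ Us, ∀ W' ∈ Us, W ≠ W' → Disjoint W W' := by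
  induction N with
  | zero => exact ⟨∅, by simp⟩
  | succ N ih =>
    obtain ⟨Us, hcard, hg, hdisj⟩ := ih (le_trans (by gcongr; omega) hN)
    have hU : (Us.biUnion id).card ≤ N * (k + 4 * (s + k)) := by
      rw [← hcard]
      exact Finset.card_biUnion_le_card_mul _ _ _ fun W hW => (hg W hW).2
    obtain ⟨C, D, T₁, T₂, hD, hDU⟩ := exists_dumbbell (U := Us.biUnion id) hH hδ hδ1 hn hρ hs hsn
      (le_trans (by gcongr; exact hU.trans (Nat.mul_le_mul_right _ (Nat.le_succ N))) hN)
    rw [← hk] at hD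
    have hgad := hD.isGadget
    have hWU : ∀ W ∈ Us, Disjoint (D ∪ T₁ ∪ T₂) W := fun W hW =>
      hDU.mono_right (Finset.subset_biUnion_of_mem id hW)
    have hnot : D ∪ T₁ ∪ T₂ ∉ Us := by
      intro h'
      have := hWU _ h'
      rw [disjoint_self, Finset.bot_eq_empty] at this
      exact hgad.1.ne_empty this
    refine ⟨insert (D ∪ T₁ ∪ T₂) Us, by rw [Finset.card_insert_of_notMem hnot, hcard], ?_, ?_⟩
    · intro W hW
      rcases Finset.mem_insert.1 hW with rfl | hW
      · exact ⟨hgad, hD.card_union_le⟩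
      · exact hg W hW
    · intro W hW W' hW' hne
      rcases Finset.mem_insert.1 hW with h1 | h1 <;> rcases Finset.mem_insert.1 hW' with h2 | h2
      · exact absurd (h1.trans h2.symm) hne
      · exact h1 ▸ hWU _ h2
      · exact h2 ▸ (hWU _ h1).symm
      · exact hdisj W h1 W' h2 hne

end GadgetFamilies

/-! ### Chains of gadgets and the moves of the depth first search -/

section Chains

variable {V : Type u}

/-- A sequence of gadgets `W i` with passages from `x i ∈ K i` to `T i`, together with links with
vertex sets `L i` from `y i ∈ T i` to `x (i + 1)`. -/
structure ChainData (V : Type u) where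
  W : ℕ → Finset V
  K : ℕ → Finset V
  T : ℕ → Finset V
  x : ℕ → V
  y : ℕ → V
  L : ℕ → Finset V

/-- The first `r` gadgets of `c` and the links between them form a chain. -/
structure IsChain (H : SimpleGraph V) (Us : Finset (Finset V)) (b s l : ℕ) (c : ChainData V)
    (r : ℕ) : Prop where
  mem : ∀ i < r, c.W i ∈ Us
  inj : ∀ i < r, ∀ j < r, c.W i = c.W j → i = j
  K_sub : ∀ i < r, c.K i ⊆ c.W i
  T_sub : ∀ i < r, c.T i ⊆ c.W i
  passage : ∀ i < r, IsPassage H b s (c.x i) (c.K i) (c.T i)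
  y_mem : ∀ i, i + 1 < r → c.y i ∈ c.T i
  link : ∀ i, i + 1 < r → Necklace H (c.y i) (c.x (i + 1)) (c.L i) 0
  link_card : ∀ i, i + 1 < r → (c.L i).card ≤ l
  link_inter : ∀ i, i + 1 < r → ∀ j < r, ∀ v ∈ c.L i, v ∈ c.K j ∪ c.T j →
    j = i ∧ v = c.y i ∨ j = i + 1 ∧ v = c.x (i + 1)
  link_disj : ∀ i, i + 1 < r → ∀ j, j + 1 < r → i ≠ j → Disjoint (c.L i) (c.L j)

/-- The vertices used by the first `r` gadgets of `c` and the links between them. -/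
noncomputable def ChainData.foot (c : ChainData V) (r : ℕ) : Finset V :=
  (Finset.range r).biUnion (fun i => c.K i ∪ c.T i) ∪ (Finset.range (r - 1)).biUnion c.L

theorem ChainData.mem_foot {c : ChainData V} {r : ℕ} {v : V} :
    v ∈ c.foot r ↔ (∃ i < r, v ∈ c.K i ∪ c.T i) ∨ ∃ i, i + 1 < r ∧ v ∈ c.L i := by
  simp only [ChainData.foot, Finset.mem_union (s := Finset.biUnion _ _), Finset.mem_biUnion,
    Finset.mem_range, Nat.lt_sub_iff_add_lt]

variable {H : SimpleGraph V} {Us : Finset (Finset V)} {b s l r : ℕ} {c : ChainData V}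

theorem IsChain.mono {r' : ℕ} (h : IsChain H Us b s l c r) (hr : r' ≤ r) :
    IsChain H Us b s l c r' where
  mem i hi := h.mem i (by omega)
  inj i hi j hj := h.inj i (by omega) j (by omega)
  K_sub i hi := h.K_sub i (by omega)
  T_sub i hi := h.T_sub i (by omega)
  passage i hi := h.passage i (by omega)
  y_mem i hi := h.y_mem i (by omega)
  link i hi := h.link i (by omega)
  link_card i hi := h.link_card i (by omega)
  link_inter i hi j hj := h.link_inter i (by omega) j (by omega)
  link_disj i hi j hj := h.link_disj i (by omega) j (by omega)

theorem IsChain.card_foot_le {M : ℕ} (h : IsChain H Us b s l c r) (hM : ∀ W ∈ Us, W.card ≤ M) :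
    (c.foot r).card ≤ r * (b + M + l) := by
  have h1 : ((Finset.range r).biUnion (fun i => c.K i ∪ c.T i)).card ≤ r * (b + M) := by
    conv_rhs => rw [← Finset.card_range r]
    refine Finset.card_biUnion_le_card_mul _ _ _ fun i hi => ?_
    have hi := Finset.mem_range.1 hi
    exact (Finset.card_union_le _ _).trans (add_le_add (h.passage i hi).card_le
      ((Finset.card_le_card (h.T_sub i hi)).trans (hM _ (h.mem i hi))))
  have h2 : ((Finset.range (r - 1)).biUnion c.L).card ≤ (r - 1) * l := by
    conv_rhs => rw [← Finset.card_range (r - 1)]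
    refine Finset.card_biUnion_le_card_mul _ _ _ fun i hi => h.link_card i ?_
    have := Finset.mem_range.1 hi
    omega
  refine (Finset.card_union_le _ _).trans ((add_le_add h1 h2).trans ?_)
  calc r * (b + M) + (r - 1) * l ≤ r * (b + M) + r * l := by gcongr; omega
    _ = r * (b + M + l) := by ring

/-- The set `Q` belongs to `Us` and is neither in the chain nor in `dead`. -/
def Unused (Us dead : Finset (Finset V)) (c : ChainData V) (r : ℕ) (Q : Finset V) : Prop :=
  Q ∈ Us ∧ Q ∉ dead ∧ ∀ i < r, c.W i ≠ Q

/-- A state of the depth first search for a chain of gadgets: `dead` are the abandoned gadgets,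
`τ` gives their exit sets, and `G` contains the discarded vertices. -/
structure IsState (H : SimpleGraph V) (Us : Finset (Finset V)) (b s l : ℕ) (c : ChainData V) (r : ℕ)
    (dead : Finset (Finset V)) (τ : Finset V → Finset V) (G : Finset V) : Prop where
  chain : IsChain H Us b s (l + 1) c r
  dead_sub : dead ⊆ Us
  notMem : ∀ i < r, c.W i ∉ dead
  τ_sub : ∀ Q ∈ dead, τ Q ⊆ Q
  le_card : ∀ Q ∈ dead, s ≤ (τ Q).card
  card_le : G.card ≤ dead.card * (b + (l + 1))
  disj : ∀ Q, Unused Us dead c r Q → ∀ i, i + 1 < r → Disjoint (c.L i) Q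
  sep : ∀ Q ∈ dead, ∀ z ∈ τ Q, ∀ Q', Unused Us dead c r Q' → ∀ z' ∈ Q',
    ¬ Near (within H ((G ∪ c.foot r : Finset V) : Set V)ᶜ) l z z'

/-- A walk avoiding `F'` has a final part that starts in `T` and avoids `F` afterwards, or avoids
`F` altogether, where `F ⊆ F' ∪ T`. -/
theorem near_or_exists_last_exit {F F' T : Set V} (hF : F ⊆ F' ∪ T) {z z' : V}
    (w : (within H F'ᶜ).Walk z z') :
    Near (within H Fᶜ) w.length z z' ∨
      ∃ y ∈ T, Near (within H (insert y Fᶜ)) w.length y z' := by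
  induction w with
  | nil => exact Or.inl (Near.refl _ _ _)
  | @cons a a' z' h p ih =>
    rw [SimpleGraph.Walk.length_cons]
    rcases ih with ih | ⟨y, hy, ih⟩
    · by_cases ha' : a' ∈ T
      · exact Or.inr ⟨a', ha', ih.mono (within_mono H (Set.subset_insert _ _)) (Nat.le_succ _)⟩
      · have ha'F : a' ∈ Fᶜ := fun h' => (hF h').elim h.2.2 ha'
        by_cases ha : a ∈ T
        · refine Or.inr ⟨a, ha, ?_⟩
          have h1 : Near (within H (insert a Fᶜ)) 1 a a' :=
            Near.of_adj ⟨h.1, Set.mem_insert _ _, Set.mem_insert_of_mem _ ha'F⟩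
          exact (h1.trans (ih.mono (within_mono H (Set.subset_insert _ _)) le_rfl)).mono le_rfl
            (by omega)
        · have haF : a ∈ Fᶜ := fun h' => (hF h').elim h.2.1 ha
          have h1 : Near (within H Fᶜ) 1 a a' := Near.of_adj ⟨h.1, haF, ha'F⟩
          exact Or.inl ((h1.trans ih).mono le_rfl (by omega))
    · exact Or.inr ⟨y, hy, ih.mono le_rfl (Nat.le_succ _)⟩

variable {dead : Finset (Finset V)} {τ : Finset V → Finset V} {G : Finset V}

/-- The last gadget of the chain is abandoned. -/
theorem IsState.pop (h : IsState H Us b s l c (r + 1) dead τ G)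
    (hno : ∀ y ∈ c.T r, ∀ Q, Unused Us dead c (r + 1) Q → ∀ z ∈ Q,
      ¬ Near (within H (insert y ((G ∪ c.foot (r + 1) : Finset V) : Set V)ᶜ)) l y z) :
    ∃ τ' G', IsState H Us b s l c r (insert (c.W r) dead) τ' G' := by
  have hnot := h.notMem r (Nat.lt_succ_self r)
  have hun : ∀ Q, Unused Us (insert (c.W r) dead) c r Q → Unused Us dead c (r + 1) Q := by
    rintro Q ⟨h1, h2, h3⟩
    rw [Finset.mem_insert, not_or] at h2
    refine ⟨h1, h2.2, fun i hi => ?_⟩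
    rcases Nat.lt_succ_iff_lt_or_eq.1 hi with hi | rfl
    · exact h3 i hi
    · exact fun h' => h2.1 h'.symm
  -- The link into the abandoned gadget; the first gadget of a chain has none.
  let E : Finset V := if r = 0 then ∅ else c.L (r - 1)
  have hE : E.card ≤ l + 1 := by
    by_cases hr : r = 0
    · simp [E, hr]
    · simp only [E, hr, if_false]
      exact h.chain.link_card _ (by omega)
  -- The core and the link move to the discarded set, so only vertices of the exit set `c.T r`
  -- become free.
  have hF : ((G ∪ c.foot (r + 1) : Finset V) : Set V) ⊆
      ((G ∪ c.K r ∪ E ∪ c.foot r : Finset V) : Set V) ∪ (c.T r : Set V) := by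
    intro v hv
    rw [← Finset.coe_union, Finset.mem_coe]
    rw [Finset.mem_coe, Finset.mem_union, ChainData.mem_foot] at hv
    simp only [Finset.mem_union, ChainData.mem_foot] at hv ⊢
    rcases hv with hv | ⟨i, hi, hv⟩ | ⟨i, hi, hv⟩
    · tauto
    · rcases Nat.lt_succ_iff_lt_or_eq.1 hi with hi | rfl
      · exact Or.inl (Or.inr (Or.inl ⟨i, hi, hv⟩))
      · tauto
    · by_cases hir : i + 1 < r
      · exact Or.inl (Or.inr (Or.inr ⟨i, hir, hv⟩))
      · have h1 : i = r - 1 := by omega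
        have h2 : r ≠ 0 := by omega
        refine Or.inl (Or.inl (Or.inr ?_))
        simp only [E, h2, if_false, ← h1, hv]
  refine ⟨Function.update τ (c.W r) (c.T r), G ∪ c.K r ∪ E, h.chain.mono (Nat.le_succ r), ?_, ?_, ?_,
    ?_, ?_, ?_, ?_⟩
  · exact Finset.insert_subset (h.chain.mem r (Nat.lt_succ_self r)) h.dead_sub
  · intro i hi
    rw [Finset.mem_insert, not_or]
    refine ⟨fun h' => ?_, h.notMem i (by omega)⟩
    have := h.chain.inj i (by omega) r (Nat.lt_succ_self r) h'
    omega
  · intro Q hQ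
    by_cases hQr : Q = c.W r
    · subst hQr
      simpa using h.chain.T_sub r (Nat.lt_succ_self r)
    · rw [Function.update_of_ne hQr]
      exact h.τ_sub Q (by simpa [hQr] using hQ)
  · intro Q hQ
    by_cases hQr : Q = c.W r
    · subst hQr
      simpa using (h.chain.passage r (Nat.lt_succ_self r)).le_card
    · rw [Function.update_of_ne hQr]
      exact h.le_card Q (by simpa [hQr] using hQ)
  · rw [Finset.card_insert_of_notMem hnot]
    have h1 := Finset.card_union_le (G ∪ c.K r) E
    have h2 := Finset.card_union_le G (c.K r)
    have h3 := (h.chain.passage r (Nat.lt_succ_self r)).card_le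
    have h4 := h.card_le
    rw [add_mul, one_mul]
    omega
  · exact fun Q hQ i hi => h.disj Q (hun Q hQ) i (by omega)
  -- A walk that profits from the freed vertices has a last exit from `c.T r`, which `hno` excludes;
  -- any other walk was already excluded by the old separation or by `hno`.
  · rintro Q hQ z hz Q' hQ' z' hz' ⟨w, hw⟩
    rcases near_or_exists_last_exit hF w with h1 | ⟨y, hy, h1⟩
    · by_cases hQr : Q = c.W r
      · subst hQr
        rw [Function.update_self] at hz
        exact hno z hz Q' (hun Q' hQ') z' hz'
          (h1.mono (within_mono H (Set.subset_insert _ _)) hw)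
      · rw [Function.update_of_ne hQr] at hz
        exact h.sep Q (by simpa [hQr] using hQ) z hz Q' (hun Q' hQ') z' hz' (h1.mono le_rfl hw)
    · exact hno y hy Q' (hun Q' hQ') z' hz' (h1.mono le_rfl hw)

/-- A larger foot and fewer unused gadgets leave fewer walks to exclude, so separation survives
starting and extending a chain. -/
theorem sep_of_subset {c' : ChainData V} {r' : ℕ}
    (h : IsState H Us b s l c r dead τ G)
    (hun : ∀ Q, Unused Us dead c' r' Q → Unused Us dead c r Q)
    (hfoot : c.foot r ⊆ c'.foot r') :
    ∀ Q ∈ dead, ∀ z ∈ τ Q, ∀ Q', Unused Us dead c' r' Q' → ∀ z' ∈ Q',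
      ¬ Near (within H ((G ∪ c'.foot r' : Finset V) : Set V)ᶜ) l z z' := by
  intro Q hQ z hz Q' hQ' z' hz' hnear
  refine h.sep Q hQ z hz Q' (hun Q' hQ') z' hz' (hnear.mono (within_mono H ?_) le_rfl)
  rw [Set.compl_subset_compl]
  exact_mod_cast Finset.union_subset_union subset_rfl hfoot

/-- A new chain is started. -/
theorem IsState.start (h : IsState H Us b s l c 0 dead τ G) (hUs : ∀ W ∈ Us, IsGadget H b s W)
    {Q : Finset V} (hQ : Unused Us dead c 0 Q) :
    ∃ c', IsState H Us b s l c' 1 dead τ G := by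
  obtain ⟨⟨x, hx⟩, hg⟩ := hUs Q hQ.1
  obtain ⟨K, T, hK, hT, hp⟩ := hg x hx
  refine ⟨⟨fun _ => Q, fun _ => K, fun _ => T, fun _ => x, fun _ => x, fun _ => ∅⟩,
    ⟨fun _ _ => hQ.1, fun i hi j hj _ => by omega, fun _ _ => hK, fun _ _ => hT, fun _ _ => hp,
      fun i hi => by omega, fun i hi => by omega, fun i hi => by omega, fun i hi => by omega,
      fun i hi => by omega⟩, h.dead_sub, fun _ _ => hQ.2.1, h.τ_sub, h.le_card, h.card_le,
    fun _ _ i hi => by omega, ?_⟩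
  refine sep_of_subset h (fun Q' hQ' => ⟨hQ'.1, hQ'.2.1, fun i hi => by omega⟩) ?_
  intro v hv
  rw [ChainData.mem_foot] at hv
  rcases hv with ⟨i, hi, -⟩ | ⟨i, hi, -⟩ <;> omega

/-- The chain is extended by a gadget that is linked to its end. -/
theorem IsState.push (h : IsState H Us b s l c (r + 1) dead τ G)
    (hUs : ∀ W ∈ Us, IsGadget H b s W)
    (hdisj : ∀ W ∈ Us, ∀ W' ∈ Us, W ≠ W' → Disjoint W W')
    {y : V} (hy : y ∈ c.T r) {Q : Finset V} (hQ : Unused Us dead c (r + 1) Q) {z : V} (hz : z ∈ Q)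
    (hnear : Near (within H (insert y ((G ∪ c.foot (r + 1) : Finset V) : Set V)ᶜ)) l y z) :
    ∃ c', IsState H Us b s l c' (r + 2) dead τ G := by
  obtain ⟨w, hw⟩ := hnear
  -- The link stops at the first vertex of any unused gadget. That gadget `R`, possibly not `Q`,
  -- comes next, and the link avoids all other unused gadgets.
  obtain ⟨x, ⟨R, hR, hxR⟩, q, hq, hql, hqs⟩ := exists_path_first_hit
    (C := {v | ∃ R, Unused Us dead c (r + 1) R ∧ v ∈ R}) w ⟨Q, hQ, hz⟩
  obtain ⟨K, T, hK, hT, hp⟩ := (hUs R hR.1).2 x hxR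
  have hqF : ∀ v ∈ q.support, v = y ∨ v ∉ c.foot (r + 1) := by
    intro v hv
    rcases support_subset_of_within q (Set.mem_insert _ _) v hv with h1 | h1
    · exact Or.inl h1
    · right
      intro h2
      exact h1 (by simp [h2])
  have hyW : y ∈ c.W r := h.chain.T_sub r (Nat.lt_succ_self r) hy
  have hWR : ∀ i < r + 1, Disjoint (c.W i) R := fun i hi =>
    hdisj _ (h.chain.mem i hi) _ hR.1 (hR.2.2 i hi)
  have hKT : ∀ i < r + 1, c.K i ∪ c.T i ⊆ c.W i := fun i hi =>
    Finset.union_subset (h.chain.K_sub i hi) (h.chain.T_sub i hi)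
  -- An earlier link can meet the last gadget's passage only at its entry, which lies in `c.K r` and
  -- so not in `c.T r`.
  have hyL : ∀ i, i + 1 < r + 1 → y ∉ c.L i := by
    intro i hi hyi
    rcases h.chain.link_inter i hi r (Nat.lt_succ_self r) y hyi (by simp [hy]) with h1 | h1
    · omega
    · have h2 := h1.2
      have h3 := h1.1
      subst h3
      exact Finset.disjoint_left.1 (h.chain.passage _ (Nat.lt_succ_self _)).disjoint
        (h.chain.passage _ (Nat.lt_succ_self _)).mem (h2 ▸ hy)
  set Λ : Finset V := q.support.toFinset with hΛ
  have hΛmem : ∀ v, v ∈ Λ ↔ v ∈ q.support := fun v => List.mem_toFinset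
  let c' : ChainData V :=
    ⟨fun i => if i ≤ r then c.W i else R, fun i => if i ≤ r then c.K i else K,
      fun i => if i ≤ r then c.T i else T, fun i => if i ≤ r then c.x i else x,
      fun i => if i < r then c.y i else y, fun i => if i < r then c.L i else Λ⟩
  have hnew : ∀ i, i < r + 2 → ¬ i ≤ r → i = r + 1 := fun i hi hi' => by omega
  have hlast : ∀ i, i + 1 < r + 2 → ¬ i < r → i = r := fun i hi hi' => by omega
  have hun : ∀ Q, Unused Us dead c' (r + 2) Q → Unused Us dead c (r + 1) Q ∧ R ≠ Q := by
    rintro Q ⟨h1, h2, h3⟩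
    refine ⟨⟨h1, h2, fun i hi => ?_⟩, ?_⟩
    · have := h3 i (by omega)
      simpa only [c', if_pos (show i ≤ r by omega)] using this
    · have := h3 (r + 1) (by omega)
      simpa only [c', if_neg (show ¬ r + 1 ≤ r by omega)] using this
  have hchain : IsChain H Us b s (l + 1) c' (r + 2) := by
    constructor
    · intro i hi
      by_cases hir : i ≤ r
      · simpa only [c', if_pos hir] using h.chain.mem i (by omega)
      · simpa only [c', if_neg hir] using hR.1
    · intro i hi j hj hij
      by_cases hir : i ≤ r <;> by_cases hjr : j ≤ r
      · simp only [c', if_pos hir, if_pos hjr] at hij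
        exact h.chain.inj i (by omega) j (by omega) hij
      · simp only [c', if_pos hir, if_neg hjr] at hij
        exact absurd hij (hR.2.2 i (by omega))
      · simp only [c', if_neg hir, if_pos hjr] at hij
        exact absurd hij.symm (hR.2.2 j (by omega))
      · omega
    · intro i hi
      by_cases hir : i ≤ r
      · simpa only [c', if_pos hir] using h.chain.K_sub i (by omega)
      · simpa only [c', if_neg hir] using hK
    · intro i hi
      by_cases hir : i ≤ r
      · simpa only [c', if_pos hir] using h.chain.T_sub i (by omega)
      · simpa only [c', if_neg hir] using hT
    · intro i hi
      by_cases hir : i ≤ r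
      · simpa only [c', if_pos hir] using h.chain.passage i (by omega)
      · simpa only [c', if_neg hir] using hp
    · intro i hi
      have h1 : i ≤ r := by omega
      by_cases hir : i < r
      · simpa only [c', if_pos hir, if_pos h1] using h.chain.y_mem i (by omega)
      · obtain rfl := hlast i hi hir
        simpa only [c', if_neg hir, if_pos h1] using hy
    · intro i hi
      by_cases hir : i < r
      · simpa only [c', if_pos hir, if_pos (show i + 1 ≤ r from hir)] using
          h.chain.link i (by omega)
      · have := Necklace.of_isPath (q.mapLe (within_le H _)) (hq.mapLe _)
        rw [SimpleGraph.Walk.support_mapLe_eq_support] at this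
        simpa only [c', if_neg hir, if_neg (show ¬ i + 1 ≤ r by omega)] using this
    · intro i hi
      by_cases hir : i < r
      · simpa only [c', if_pos hir] using h.chain.link_card i (by omega)
      · simp only [c', if_neg hir]
        refine (List.toFinset_card_le _).trans ?_
        rw [SimpleGraph.Walk.length_support]
        omega
    · intro i hi j hj v hv hvj
      by_cases hir : i < r <;> by_cases hjr : j ≤ r
      · simp only [c', if_pos hir, if_pos hjr, if_pos (show i + 1 ≤ r from hir)] at hv hvj ⊢
        exact h.chain.link_inter i (by omega) j (by omega) v hv hvj
      · simp only [c', if_pos hir, if_neg hjr] at hv hvj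
        exact absurd (Finset.union_subset hK hT hvj)
          (Finset.disjoint_left.1 (h.disj R hR i (by omega)) hv)
      · obtain rfl := hlast i hi hir
        simp only [c', if_neg hir, if_pos hjr] at hv hvj ⊢
        have hvf : v ∈ c.foot (i + 1) := ChainData.mem_foot.2 (Or.inl ⟨j, by omega, hvj⟩)
        rcases hqF v ((hΛmem v).1 hv) with h1 | h1
        · refine Or.inl ⟨?_, h1⟩
          by_contra hne
          refine Finset.disjoint_left.1 (hdisj _ (h.chain.mem j (by omega)) _
            (h.chain.mem i (by omega)) fun h' => hne ?_) (hKT j (by omega) hvj) (h1 ▸ hyW)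
          exact h.chain.inj j (by omega) i (by omega) h'
        · exact absurd hvf h1
      · obtain rfl := hlast i hi hir
        obtain rfl := hnew j hj hjr
        simp only [c', if_neg hir, if_neg hjr] at hv hvj ⊢
        exact Or.inr ⟨trivial, (hqs v ((hΛmem v).1 hv)).2 ⟨R, hR, Finset.union_subset hK hT hvj⟩⟩
    · have key : ∀ i, i < r → Disjoint (c.L i) Λ := by
        intro i hi
        refine Finset.disjoint_left.2 fun v hv hv' => ?_
        rcases hqF v ((hΛmem v).1 hv') with rfl | h1
        · exact hyL i (by omega) hv
        · exact h1 (ChainData.mem_foot.2 (Or.inr ⟨i, by omega, hv⟩))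
      intro i hi j hj hij
      by_cases hir : i < r <;> by_cases hjr : j < r
      · simpa only [c', if_pos hir, if_pos hjr] using
          h.chain.link_disj i (by omega) j (by omega) hij
      · simpa only [c', if_pos hir, if_neg hjr] using key i hir
      · simpa only [c', if_neg hir, if_pos hjr] using (key j hjr).symm
      · omega
  refine ⟨c', hchain, h.dead_sub, ?_, h.τ_sub, h.le_card, h.card_le, ?_, ?_⟩
  · intro i hi
    by_cases hir : i ≤ r
    · simpa only [c', if_pos hir] using h.notMem i (by omega)
    · simpa only [c', if_neg hir] using hR.2.1
  · intro Q' hQ' i hi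
    obtain ⟨h1, h2⟩ := hun Q' hQ'
    by_cases hir : i < r
    · simpa only [c', if_pos hir] using h.disj Q' h1 i (by omega)
    · simp only [c', if_neg hir]
      refine Finset.disjoint_left.2 fun v hv hv' => ?_
      have := (hqs v ((hΛmem v).1 hv)).2 ⟨Q', h1, hv'⟩
      subst this
      exact Finset.disjoint_left.1 (hdisj R hR.1 Q' h1.1 h2) hxR hv'
  · refine sep_of_subset h (fun Q' hQ' => (hun Q' hQ').1) fun v hv => ?_
    rw [ChainData.mem_foot] at hv ⊢
    rcases hv with ⟨i, hi, hv⟩ | ⟨i, hi, hv⟩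
    · refine Or.inl ⟨i, by omega, ?_⟩
      simpa only [c', if_pos (show i ≤ r by omega)] using hv
    · refine Or.inr ⟨i, by omega, ?_⟩
      simpa only [c', if_pos (show i < r by omega)] using hv

end Chains

/-! ### The depth first search yields a long chain -/

section ChainExistence

variable {V : Type u} {H : SimpleGraph V} {Us : Finset (Finset V)} {b s r ρ : ℕ}
  {c : ChainData V} {dead : Finset (Finset V)} {τ : Finset V → Finset V} {G : Finset V} {δ : ℝ}

theorem card_le_card_unused {m R : ℕ} (hN : 2 * m + R ≤ Us.card) (hr : r ≤ R)
    (hdead : dead.card ≤ m) :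
    m ≤ (Us.filter (fun Q => Unused Us dead c r Q)).card := by
  have h1 : Us ⊆ Us.filter (fun Q => Unused Us dead c r Q) ∪ dead ∪ (Finset.range r).image c.W := by
    intro Q hQ
    by_cases hd : Q ∈ dead
    · simp [hd]
    · by_cases hc : ∃ i < r, c.W i = Q
      · refine Finset.mem_union_right _ ?_
        simpa using hc
      · push Not at hc
        exact Finset.mem_union_left _ (Finset.mem_union_left _
          (Finset.mem_filter.2 ⟨hQ, hQ, hd, hc⟩))
  have h2 := Finset.card_le_card h1
  have h3 := Finset.card_union_le (Us.filter (fun Q => Unused Us dead c r Q) ∪ dead)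
    ((Finset.range r).image c.W)
  have h4 := Finset.card_union_le (Us.filter (fun Q => Unused Us dead c r Q)) dead
  have h5 := (Finset.card_image_le (s := Finset.range r) (f := c.W))
  rw [Finset.card_range] at h5
  omega

theorem mul_le_card_biUnion {ι : Type*} (S : Finset ι) (f : ι → Finset V)
    (hf : ∀ i ∈ S, s ≤ (f i).card) (hd : ∀ i ∈ S, ∀ j ∈ S, i ≠ j → Disjoint (f i) (f j)) :
    S.card * s ≤ (S.biUnion f).card := by
  rw [Finset.card_biUnion fun i hi j hj => hd i hi j hj, ← smul_eq_mul]
  exact Finset.card_nsmul_le_sum _ _ _ hf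

/-- The exit sets of the `m` abandoned gadgets cover at least `m * s` vertices, and so do the unused
gadgets, of which at least `m` remain. The discarded and used vertices number at most δ/4 times
that, so expansion joins the two sides by a walk of length at most 2ρ, against `sep`. -/
theorem IsState.false_of_card_eq [Fintype V] (h : IsState H Us b s (ρ + ρ) c r dead τ G)
    (hH : HasExpansion H δ) (hδ : 0 < δ) (hδ1 : δ ≤ 1)
    (hρ : (Fintype.card V : ℝ) < (1 + δ / 2) ^ ρ)
    (hUs : ∀ W ∈ Us, IsGadget H b s W)
    (hdisj : ∀ W ∈ Us, ∀ W' ∈ Us, W ≠ W' → Disjoint W W') {M m R : ℕ}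
    (hM : ∀ W ∈ Us, W.card ≤ M) (hdead : dead.card = m) (hr : r ≤ R) (hN : 2 * m + R ≤ Us.card)
    (hms : 16 ≤ m * s)
    (hcount : ((m * (b + (ρ + ρ + 1)) + R * (b + M + (ρ + ρ + 1)) : ℕ) : ℝ) ≤
      δ / 4 * ((m * s : ℕ) : ℝ)) : False := by
  set F := G ∪ c.foot r with hF
  have hFcard : (F.card : ℝ) ≤ δ / 4 * ((m * s : ℕ) : ℝ) := by
    refine le_trans ?_ hcount
    have h1 := Finset.card_union_le G (c.foot r)
    have h2 := h.card_le
    have h3 := h.chain.card_foot_le hM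
    have h4 : r * (b + M + (ρ + ρ + 1)) ≤ R * (b + M + (ρ + ρ + 1)) := Nat.mul_le_mul_right _ hr
    rw [hdead] at h2
    exact_mod_cast h1.trans (add_le_add h2 (h3.trans h4))
  have hms' : (16 : ℝ) ≤ ((m * s : ℕ) : ℝ) := by exact_mod_cast hms
  have hlarge : ∀ X : Finset V, m * s ≤ X.card → 8 ≤ (X \ F).card ∧
      (F.card : ℝ) ≤ δ / 2 * ((X \ F).card : ℝ) := by
    intro X hX
    have h1 : X.card ≤ (X \ F).card + F.card := by
      have := Finset.le_card_sdiff F X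
      omega
    have h2 : ((m * s : ℕ) : ℝ) ≤ (X \ F).card + F.card := by exact_mod_cast hX.trans h1
    have h3 : ((m * s : ℕ) : ℝ) / 2 ≤ (X \ F).card := by nlinarith
    refine ⟨?_, by nlinarith⟩
    have : (8 : ℝ) ≤ (X \ F).card := by linarith
    exact_mod_cast this
  obtain ⟨hA1, hA2⟩ := hlarge (dead.biUnion τ) (by
    rw [← hdead]
    exact mul_le_card_biUnion _ _ h.le_card fun Q hQ Q' hQ' hne =>
      (hdisj Q (h.dead_sub hQ) Q' (h.dead_sub hQ') hne).mono (h.τ_sub Q hQ) (h.τ_sub Q' hQ'))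
  obtain ⟨hB1, hB2⟩ := hlarge ((Us.filter (fun Q => Unused Us dead c r Q)).biUnion id) (by
    refine le_trans (Nat.mul_le_mul_right s (card_le_card_unused hN hr hdead.le))
      (mul_le_card_biUnion _ _ (fun Q hQ => (hUs Q (Finset.mem_filter.1 hQ).1).le_card)
        fun Q hQ Q' hQ' hne =>
          hdisj Q (Finset.mem_filter.1 hQ).1 Q' (Finset.mem_filter.1 hQ').1 hne))
  obtain ⟨a, ha, z, hz, hnear⟩ := exists_near_of_large hH hδ hρ hA1 hA2 hB1 hB2
    Finset.sdiff_disjoint Finset.sdiff_disjoint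
  obtain ⟨Q, hQ, haQ⟩ := Finset.mem_biUnion.1 (Finset.mem_sdiff.1 ha).1
  obtain ⟨Q', hQ', hzQ⟩ := Finset.mem_biUnion.1 (Finset.mem_sdiff.1 hz).1
  rw [Finset.coe_compl] at hnear
  exact h.sep Q hQ a haQ Q' (Finset.mem_filter.1 hQ').2 z hzQ hnear

/-- Depth first search among disjoint gadgets of an expander produces a long chain. -/
theorem exists_chain [Fintype V] (hH : HasExpansion H δ) (hδ : 0 < δ) (hδ1 : δ ≤ 1)
    (hρ : (Fintype.card V : ℝ) < (1 + δ / 2) ^ ρ)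
    (hUs : ∀ W ∈ Us, IsGadget H b s W)
    (hdisj : ∀ W ∈ Us, ∀ W' ∈ Us, W ≠ W' → Disjoint W W') {M m R : ℕ}
    (hM : ∀ W ∈ Us, W.card ≤ M) (hR : 1 ≤ R) (hN : 2 * m + R ≤ Us.card) (hms : 16 ≤ m * s)
    (hcount : ((m * (b + (ρ + ρ + 1)) + R * (b + M + (ρ + ρ + 1)) : ℕ) : ℝ) ≤
      δ / 4 * ((m * s : ℕ) : ℝ)) :
    ∃ c, IsChain H Us b s (ρ + ρ + 1) c R := by
  by_contra hno
  have hm : 1 ≤ m := by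
    rcases Nat.eq_zero_or_pos m with h0 | h0
    · rw [h0] at hms; omega
    · exact h0
  -- Every move raises `2 * dead.card + r` by one: a start or push adds a gadget to the chain, a pop
  -- turns one into a dead one. As `r < R` and `dead.card < m`, the search cannot go on for `2 * m +
  -- R` moves.
  have key : ∀ t, ∃ c r dead τ G, IsState H Us b s (ρ + ρ) c r dead τ G ∧ r < R ∧
      dead.card < m ∧ 2 * dead.card + r = t := by
    intro t
    induction t with
    | zero =>
      obtain ⟨W, hW⟩ := Finset.card_pos.1 (show 0 < Us.card by omega)
      obtain ⟨x, -⟩ := (hUs W hW).1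
      refine ⟨⟨fun _ => ∅, fun _ => ∅, fun _ => ∅, fun _ => x, fun _ => x, fun _ => ∅⟩, 0, ∅,
        fun _ => ∅, ∅, ⟨?_, by simp, by simp, by simp, by simp, by simp, ?_, by simp⟩, hR,
        by rw [Finset.card_empty]; omega, by simp⟩
      · constructor <;> intro i hi <;> omega
      · intro _ _ i hi; omega
    | succ t ih =>
      obtain ⟨c, r, dead, τ, G, h, hr, hd, ht⟩ := ih
      have hlt : ∀ c', IsState H Us b s (ρ + ρ) c' (r + 1) dead τ G → r + 1 < R := by
        intro c' h'
        refine lt_of_le_of_ne hr fun hrR => hno ⟨c', ?_⟩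
        rw [← hrR]
        exact h'.chain
      rcases r with _ | r
      · obtain ⟨Q, hQ⟩ := Finset.card_pos.1
          (hm.trans (card_le_card_unused (c := c) (r := 0) hN hr.le hd.le))
        obtain ⟨c', h'⟩ := h.start hUs (Finset.mem_filter.1 hQ).2
        exact ⟨c', 1, dead, τ, G, h', hlt c' h', hd, by omega⟩
      · by_cases hpush : ∃ y ∈ c.T r, ∃ Q, Unused Us dead c (r + 1) Q ∧ ∃ z ∈ Q,
            Near (within H (insert y ((G ∪ c.foot (r + 1) : Finset V) : Set V)ᶜ)) (ρ + ρ) y z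
        · obtain ⟨y, hy, Q, hQ, z, hz, hnear⟩ := hpush
          obtain ⟨c', h'⟩ := h.push hUs hdisj hy hQ hz hnear
          exact ⟨c', r + 2, dead, τ, G, h', hlt c' h', hd, by omega⟩
        · push Not at hpush
          obtain ⟨τ', G', h'⟩ := h.pop hpush
          have hcard := Finset.card_insert_of_notMem (h.notMem r (Nat.lt_succ_self r))
          refine ⟨c, r, _, τ', G', h', by omega, ?_, by omega⟩
          refine lt_of_le_of_ne (by omega) fun hdm => ?_
          exact h'.false_of_card_eq hH hδ hδ1 hρ hUs hdisj hM hdm (R := R) (by omega) hN hms hcount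
  obtain ⟨c, r, dead, τ, G, -, hr, hd, ht⟩ := key (2 * m + R)
  omega

end ChainExistence

/-! ### Closing a long chain to a wheel -/

section Closing

variable {V : Type u} {H : SimpleGraph V} {Us : Finset (Finset V)} {b s l r : ℕ}
  {c : ChainData V}

theorem IsChain.eq_of_mem (h : IsChain H Us b s l c r)
    (hdisj : ∀ W ∈ Us, ∀ W' ∈ Us, W ≠ W' → Disjoint W W') {i j : ℕ} (hi : i < r) (hj : j < r)
    {v : V} (hvi : v ∈ c.K i ∪ c.T i) (hvj : v ∈ c.K j ∪ c.T j) : i = j := by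
  by_contra hne
  exact Finset.disjoint_left.1 (hdisj _ (h.mem i hi) _ (h.mem j hj)
    fun h' => hne (h.inj i hi j hj h')) (Finset.union_subset (h.K_sub i hi) (h.T_sub i hi) hvi)
    (Finset.union_subset (h.K_sub j hj) (h.T_sub j hj) hvj)

/-- The part of a chain from the exit of one gadget to the entry of a later one. -/
theorem IsChain.exists_necklace (h : IsChain H Us b s l c r)
    (hdisj : ∀ W ∈ Us, ∀ W' ∈ Us, W ≠ W' → Disjoint W W') (p : ℕ) (j : ℕ) (hj : p + j + 1 < r) :
    ∃ S, Necklace H (c.y p) (c.x (p + j + 1)) S j ∧ S.card ≤ (j + 1) * l + j * b ∧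
      ∀ v ∈ S, (∃ i, p ≤ i ∧ i ≤ p + j ∧ v ∈ c.L i) ∨
        ∃ i, p < i ∧ i ≤ p + j ∧ v ∈ c.K i ∪ c.T i := by
  induction j with
  | zero =>
    exact ⟨c.L p, h.link p hj, by simpa using h.link_card p hj,
      fun v hv => Or.inl ⟨p, le_rfl, le_rfl, hv⟩⟩
  | succ j ih =>
    obtain ⟨S, hS, hSc, hSv⟩ := ih (by omega)
    set q := p + j + 1 with hq
    have hq1 : q + 1 < r := hj
    obtain ⟨S', hS', hS'sub, hS'c⟩ := (h.passage q (by omega)).exists_necklace _ (h.y_mem q hq1)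
    have h1 := hS.append hS' (by
      ext v
      simp only [Finset.mem_inter, Finset.mem_singleton]
      constructor
      · rintro ⟨hv, hv'⟩
        rcases hSv v hv with ⟨i, h1, h2, h3⟩ | ⟨i, h1, h2, h3⟩
        · rcases h.link_inter i (by omega) q (by omega) v h3 (hS'sub hv') with h4 | h4
          · omega
          · rw [h4.1]; exact h4.2
        · have := h.eq_of_mem hdisj (by omega) (by omega) h3 (hS'sub hv')
          omega
      · rintro rfl
        exact ⟨hS.right_mem, hS'.left_mem⟩)
    have h2 := h1.append (h.link q hq1) (by
      ext v
      simp only [Finset.mem_inter, Finset.mem_singleton, Finset.mem_union]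
      constructor
      · rintro ⟨hv | hv, hv'⟩
        · rcases hSv v hv with ⟨i, h1, h2, h3⟩ | ⟨i, h1, h2, h3⟩
          · exact absurd hv' (Finset.disjoint_left.1
              (h.link_disj i (by omega) q hq1 (by omega)) h3)
          · rcases h.link_inter q hq1 i (by omega) v hv' h3 with h4 | h4
            · omega
            · omega
        · rcases h.link_inter q hq1 q (by omega) v hv' (hS'sub hv) with h4 | h4
          · exact h4.2
          · omega
      · rintro rfl
        exact ⟨Or.inr hS'.right_mem, (h.link q hq1).left_mem⟩)
    refine ⟨_, h2, ?_, fun v hv => ?_⟩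
    · have h3 := Finset.card_union_le (S ∪ S') (c.L q)
      have h4 := Finset.card_union_le S S'
      have h5 := h.link_card q hq1
      have h6 : (j + 1 + 1) * l + (j + 1) * b = ((j + 1) * l + j * b) + b + l := by ring
      omega
    · rcases Finset.mem_union.1 hv with hv | hv
      · rcases Finset.mem_union.1 hv with hv | hv
        · rcases hSv v hv with ⟨i, h1, h2, h3⟩ | ⟨i, h1, h2, h3⟩
          · exact Or.inl ⟨i, h1, by omega, h3⟩
          · exact Or.inr ⟨i, h1, by omega, h3⟩
        · exact Or.inr ⟨q, by omega, by omega, hS'sub hv⟩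
      · exact Or.inl ⟨q, by omega, by omega, hv⟩

theorem IsChain.reachable_exit (h : IsChain H Us b s l c r) {X : Set V} {i : ℕ} (hi : i < r)
    (hX : ∀ v ∈ c.K i ∪ c.T i, v ∈ X) {y : V} (hy : y ∈ c.T i) :
    (within H X).Reachable (c.x i) y := by
  obtain ⟨S, hS, hSsub, -⟩ := (h.passage i hi).exists_necklace y hy
  exact hS.reachable.mono (within_mono H fun v hv => hX v (hSsub hv))

theorem IsChain.reachable_segment (h : IsChain H Us b s l c r) {X : Set V} {p q : ℕ} (hq : q < r)
    (hX : ∀ i, p ≤ i → i ≤ q → ∀ v ∈ c.K i ∪ c.T i, v ∈ X)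
    (hL : ∀ i, p ≤ i → i < q → ∀ v ∈ c.L i, v ∈ X) {i : ℕ} (hpi : p ≤ i) (hiq : i ≤ q) :
    (within H X).Reachable (c.x p) (c.x i) := by
  induction i, hpi using Nat.le_induction with
  | base => rfl
  | succ i hpi ih =>
    refine (ih (by omega)).trans
      ((h.reachable_exit (by omega) (hX i hpi (by omega)) (h.y_mem i (by omega))).trans ?_)
    exact (h.link i (by omega)).reachable.mono (within_mono H (hL i hpi hiq))

/-- In an expander, a long chain of gadgets can be closed to a wheel. -/
theorem IsChain.exists_wheel [Fintype V] {δ : ℝ} {ρ t : ℕ} (h : IsChain H Us b s l c (3 * t))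
    (hdisj : ∀ W ∈ Us, ∀ W' ∈ Us, W ≠ W' → Disjoint W W')
    (hH : HasExpansion H δ) (hδ : 0 < δ) (hρ : (Fintype.card V : ℝ) < (1 + δ / 2) ^ ρ)
    (ht : 2 ≤ t) (hts : 8 ≤ t * s) (hs : 2 * ((b + l : ℕ) : ℝ) ≤ δ / 2 * s) :
    ∃ W : H.Subgraph, IsWheel W t := by
  obtain ⟨u, rfl⟩ : ∃ u, t = u + 1 := ⟨t - 1, by omega⟩
  -- The chain splits in thirds: gadgets up to `p = t - 1`, the `t` gadgets whose cycles enter the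
  -- wheel, and gadgets from `q = 2 * t` on.
  set p := u with hp
  obtain ⟨S, hS, hSc, hSv⟩ := h.exists_necklace hdisj p (u + 1) (by omega)
  set q := p + (u + 1) + 1 with hq
  set X : Set V := {v | v ∈ S → v = c.y p ∨ v = c.x q} with hX
  have hKT : ∀ i < 3 * (u + 1), (i ≤ p ∨ q ≤ i) → ∀ v ∈ c.K i ∪ c.T i, v ∈ X := by
    intro i hi hiq v hv hvS
    rcases hSv v hvS with ⟨j, h1, h2, h3⟩ | ⟨j, h1, h2, h3⟩
    · rcases h.link_inter j (by omega) i hi v h3 hv with h4 | h4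
      · have : j = p := by omega
        rw [this] at h4
        exact Or.inl h4.2
      · have : j + 1 = q := by omega
        rw [this] at h4
        exact Or.inr h4.2
    · have := h.eq_of_mem hdisj (by omega) hi h3 hv
      omega
  have hL : ∀ i, i + 1 < 3 * (u + 1) → (i < p ∨ q ≤ i) → ∀ v ∈ c.L i, v ∈ X := by
    intro i hi hiq v hv hvS
    rcases hSv v hvS with ⟨j, h1, h2, h3⟩ | ⟨j, h1, h2, h3⟩
    · exact absurd h3 (Finset.disjoint_left.1 (h.link_disj i hi j (by omega) (by omega)) hv)
    · rcases h.link_inter i hi j (by omega) v hv h3 with h4 | h4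
      · omega
      · omega
  have hleft : ∀ i ≤ p, (within H X).Reachable (c.x 0) (c.x i) := fun i hi =>
    h.reachable_segment (q := p) (by omega) (fun j _ hj => hKT j (by omega) (Or.inl hj))
      (fun j _ hj => hL j (by omega) (Or.inl hj)) (Nat.zero_le i) hi
  have hright : ∀ i, q ≤ i → i < 3 * (u + 1) → (within H X).Reachable (c.x q) (c.x i) :=
    fun i hi hi' => h.reachable_segment (q := i) hi'
      (fun j hj hj' => hKT j (by omega) (Or.inr hj))
      (fun j hj hj' => hL j (by omega) (Or.inr hj)) hi le_rfl
  have hTd : ∀ i < 3 * (u + 1), ∀ j < 3 * (u + 1), i ≠ j → Disjoint (c.T i) (c.T j) := by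
    intro i hi j hj hij
    refine Finset.disjoint_left.2 fun v hv hv' => hij ?_
    exact h.eq_of_mem hdisj hi hj (Finset.mem_union_right _ hv) (Finset.mem_union_right _ hv')
  -- The two ends are left out because they belong to gadgets of the outer thirds, whose exit sets
  -- have to be disjoint from `F`.
  set F : Finset V := (S.erase (c.y p)).erase (c.x q) with hF
  have hFX : ((Fᶜ : Finset V) : Set V) ⊆ X := by
    intro v hv hvS
    by_contra hne
    rw [not_or] at hne
    simp [hF, hne.1, hne.2, hvS] at hv
  have hFcard : (F.card : ℝ) ≤ δ / 2 * (((u + 1) * s : ℕ) : ℝ) := by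
    have h1 : F.card ≤ S.card := Finset.card_le_card
      ((Finset.erase_subset _ _).trans (Finset.erase_subset _ _))
    have h2 : F.card ≤ (u + 1) * (2 * (b + l)) := by
      refine h1.trans (hSc.trans ?_)
      nlinarith
    have h3 : (F.card : ℝ) ≤ ((u : ℝ) + 1) * (2 * ((b + l : ℕ) : ℝ)) := by exact_mod_cast h2
    refine h3.trans ?_
    rw [Nat.cast_mul]
    push_cast at hs ⊢
    have : (0 : ℝ) ≤ (u : ℝ) + 1 := by positivity
    nlinarith
  have hlarge : ∀ I : Finset ℕ, I.card = u + 1 →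
      (∀ i ∈ I, i < 3 * (u + 1) ∧ (i ≤ p ∨ q ≤ i)) →
      8 ≤ (I.biUnion c.T).card ∧ (F.card : ℝ) ≤ δ / 2 * ((I.biUnion c.T).card : ℝ) ∧
        Disjoint (I.biUnion c.T) F := by
    intro I hI hIi
    have h1 : (u + 1) * s ≤ (I.biUnion c.T).card := by
      rw [← hI]
      exact mul_le_card_biUnion _ _ (fun i hi => (h.passage i (hIi i hi).1).le_card)
        fun i hi j hj => hTd i (hIi i hi).1 j (hIi j hj).1
    refine ⟨hts.trans h1, hFcard.trans ?_, ?_⟩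
    · exact mul_le_mul_of_nonneg_left (by exact_mod_cast h1) (by positivity)
    · refine Finset.disjoint_left.2 fun v hv hvF => ?_
      obtain ⟨i, hi, hvi⟩ := Finset.mem_biUnion.1 hv
      simp only [hF, Finset.mem_erase] at hvF
      rcases hKT i (hIi i hi).1 (hIi i hi).2 v (Finset.mem_union_right _ hvi) hvF.2.2 with h4 | h4
      · exact hvF.2.1 h4
      · exact hvF.1 h4
  obtain ⟨hA1, hA2, hA3⟩ := hlarge (Finset.range (u + 1)) (by simp) fun i hi => by
    rw [Finset.mem_range] at hi; omega
  obtain ⟨hB1, hB2, hB3⟩ := hlarge (Finset.Ico q (3 * (u + 1))) (by simp; omega) fun i hi => by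
    rw [Finset.mem_Ico] at hi; omega
  obtain ⟨a, ha, z, hz, w, -⟩ := exists_near_of_large hH hδ hρ hA1 hA2 hB1 hB2 hA3 hB3
  obtain ⟨i, hi, hai⟩ := Finset.mem_biUnion.1 ha
  obtain ⟨j, hj, hzj⟩ := Finset.mem_biUnion.1 hz
  rw [Finset.mem_range] at hi
  rw [Finset.mem_Ico] at hj
  have h1 : (within H X).Reachable (c.x 0) a := (hleft i (by omega)).trans
    (h.reachable_exit (by omega) (hKT i (by omega) (Or.inl (by omega))) hai)
  have h2 : (within H X).Reachable (c.x q) z := (hright j hj.1 hj.2).trans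
    (h.reachable_exit hj.2 (hKT j hj.2 (Or.inr hj.1)) hzj)
  have h3 : (within H X).Reachable (c.x 0) (c.y p) := (hleft p le_rfl).trans
    (h.reachable_exit (by omega) (hKT p (by omega) (Or.inl le_rfl)) (h.y_mem p (by omega)))
  have h4 : (within H X).Reachable a z := ⟨w.mapLe (within_mono H hFX)⟩
  refine hS.exists_wheel_of_reachable ht ?_ (h2.trans (h4.symm.trans (h1.symm.trans h3)))
  intro hne
  have := h.eq_of_mem hdisj (i := p) (j := q) (by omega) (by omega)
    (Finset.mem_union_right _ (h.y_mem p (by omega)))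
    (hne ▸ Finset.mem_union_left _ (h.passage q (by omega)).mem)
  omega

end Closing

/-! ### Choice of the parameters -/

section Parameters

/-- Passages and links use O(ρ²) vertices. The search needs 2m + 3t gadgets, with m of order t/δ, of
at most 5s vertices each, with s of order ρ²/δ. Their total, of order tρ²/δ², must stay below
δn/100, which is what `hcard` provides. -/
theorem exists_wheel_of_parameters {V : Type u} [Fintype V] {H : SimpleGraph V} {δ : ℝ}
    (hH : HasExpansion H δ) (hδ : 0 < δ) (hδ1 : δ ≤ 1) (hn : 32 ≤ Fintype.card V) {ρ t : ℕ}
    (hρ1 : 1 ≤ ρ) (hρ : (Fintype.card V : ℝ) < (1 + δ / 100) ^ ρ) (ht : 2 ≤ t)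
    (hcard : 10 ^ 8 * ((t : ℝ) * ρ ^ 2) ≤ δ ^ 3 * Fintype.card V) :
    ∃ W : H.Subgraph, IsWheel W t := by
  set n : ℝ := (Fintype.card V : ℝ) with hn'
  obtain ⟨k, hk⟩ : ∃ k, k = 2 * ((2 * (4 * ρ + 1) + 1) * ρ + 2 * (4 * ρ + 1)) + 1 := ⟨_, rfl⟩
  -- A passage and a link use at most 58ρ² vertices, and 8 · 58 < 500 makes this at most δs/8.
  set s : ℕ := ⌈500 * (ρ : ℝ) ^ 2 / δ⌉₊ with hs
  -- The chain of 3t gadgets, counted with at most 6s vertices each, has to stay below δms/8, and 8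
  -- · 3 · 6 = 144.
  set m : ℕ := ⌈144 * (t : ℝ) / δ⌉₊ with hm
  have hρ1' : (1 : ℝ) ≤ ρ := by exact_mod_cast hρ1
  have ht' : (2 : ℝ) ≤ t := by exact_mod_cast ht
  have hρ2 : (1 : ℝ) ≤ (ρ : ℝ) ^ 2 := one_le_pow₀ hρ1'
  have hkρ : (k : ℝ) ≤ 43 * (ρ : ℝ) ^ 2 := by
    rw [hk]; push_cast; nlinarith
  have hbl : ((k + 2 * (4 * ρ + 1 + 1) + (ρ + ρ + 1) : ℕ) : ℝ) ≤ 58 * (ρ : ℝ) ^ 2 := by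
    rw [hk]; push_cast; nlinarith
  have hs1 : 500 * (ρ : ℝ) ^ 2 ≤ δ * s := by
    have := Nat.le_ceil (500 * (ρ : ℝ) ^ 2 / δ)
    rw [div_le_iff₀ hδ] at this
    linarith
  have hs0 : (0 : ℝ) ≤ s := Nat.cast_nonneg _
  have hs1' : 500 * (ρ : ℝ) ^ 2 ≤ s := hs1.trans (by nlinarith)
  have hs2 : δ * s ≤ 501 * (ρ : ℝ) ^ 2 := by
    have h1 := Nat.ceil_lt_add_one (show 0 ≤ 500 * (ρ : ℝ) ^ 2 / δ by positivity)
    rw [← hs] at h1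
    have h2 : δ * (500 * (ρ : ℝ) ^ 2 / δ) = 500 * (ρ : ℝ) ^ 2 := by field_simp
    nlinarith
  have hm1 : 144 * (t : ℝ) ≤ δ * m := by
    have := Nat.le_ceil (144 * (t : ℝ) / δ)
    rw [div_le_iff₀ hδ] at this
    linarith
  have hm0 : (0 : ℝ) ≤ m := Nat.cast_nonneg _
  have hm1' : 144 * (t : ℝ) ≤ m := hm1.trans (by nlinarith)
  have hm2 : δ * m ≤ 145 * t := by
    have h1 := Nat.ceil_lt_add_one (show 0 ≤ 144 * (t : ℝ) / δ by positivity)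
    rw [← hm] at h1
    have h2 : δ * (144 * (t : ℝ) / δ) = 144 * t := by field_simp
    nlinarith
  have hk0 : (0 : ℝ) ≤ k := Nat.cast_nonneg _
  have hM : ((k + 4 * (s + k) : ℕ) : ℝ) ≤ 5 * s := by
    push_cast; linarith
  have hN : 100 * ((((2 * m + 3 * t) * (k + 4 * (s + k)) : ℕ)) : ℝ) ≤ δ * n := by
    rw [Nat.cast_mul]
    have h1 : ((2 * m + 3 * t : ℕ) : ℝ) * δ ≤ 293 * t := by
      push_cast; nlinarith
    have h2 : ((k + 4 * (s + k) : ℕ) : ℝ) * δ ≤ 2505 * (ρ : ℝ) ^ 2 := by nlinarith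
    have h3 : (((2 * m + 3 * t : ℕ) : ℝ) * δ) * (((k + 4 * (s + k) : ℕ) : ℝ) * δ) ≤
        (293 * t) * (2505 * (ρ : ℝ) ^ 2) := mul_le_mul h1 h2 (by positivity) (by positivity)
    have h4 : (0 : ℝ) ≤ (t : ℝ) * ρ ^ 2 := by positivity
    have h5 : δ ^ 2 * (100 * (((2 * m + 3 * t : ℕ) : ℝ) * ((k + 4 * (s + k) : ℕ) : ℝ))) ≤
        δ ^ 2 * (δ * n) := by
      nlinarith
    exact le_of_mul_le_mul_left h5 (by positivity)
  have hsn : 800 * ((s + k : ℕ) : ℝ) ≤ δ * n := by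
    refine le_trans ?_ hN
    have h1 : 8 * (s + k) ≤ (2 * m + 3 * t) * (k + 4 * (s + k)) := by
      calc 8 * (s + k) ≤ 6 * (4 * (s + k)) := by omega
        _ ≤ (2 * m + 3 * t) * (k + 4 * (s + k)) := Nat.mul_le_mul (by omega) (by omega)
    have h2 : 8 * ((s + k : ℕ) : ℝ) ≤ ((2 * m + 3 * t) * (k + 4 * (s + k)) : ℕ) := by
      exact_mod_cast h1
    linarith
  have hs100 : 100 ≤ δ * ((s + k : ℕ) : ℝ) := by
    push_cast; nlinarith
  have hρ' : (Fintype.card V : ℝ) < (1 + δ / 2) ^ ρ :=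
    hρ.trans_le (pow_le_pow_left₀ (by positivity) (by linarith) _)
  have hms : 16 ≤ m * s := by
    have h1 : (16 : ℝ) ≤ m := by linarith
    have h2 : (1 : ℝ) ≤ s := by linarith
    have h1' : 16 ≤ m := by exact_mod_cast h1
    have h2' : 1 ≤ s := by exact_mod_cast h2
    exact Nat.mul_le_mul h1' h2'
  have hts : 8 ≤ t * s := by
    have h2 : (4 : ℝ) ≤ s := by linarith
    have h2' : 4 ≤ s := by exact_mod_cast h2
    exact Nat.mul_le_mul ht h2'
  obtain ⟨Us, hUcard, hUs, hdisj⟩ := exists_gadget_family hH hδ hδ1 hn hρ hk hs100 hsn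
    (2 * m + 3 * t) hN
  obtain ⟨c, hc⟩ := exists_chain (m := m) (R := 3 * t) hH hδ hδ1 hρ' (fun W hW => (hUs W hW).1)
    hdisj (fun W hW => (hUs W hW).2) (by omega) hUcard.ge hms (by
      have h1 : ((m * (k + 2 * (4 * ρ + 1 + 1) + (ρ + ρ + 1)) : ℕ) : ℝ) ≤ δ / 8 * (m * s) := by
        rw [Nat.cast_mul]
        nlinarith
      have h2 : ((k + 2 * (4 * ρ + 1 + 1) + (k + 4 * (s + k)) + (ρ + ρ + 1) : ℕ) : ℝ) ≤ 6 * s := by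
        have h3 : ((k + 2 * (4 * ρ + 1 + 1) + (k + 4 * (s + k)) + (ρ + ρ + 1) : ℕ) : ℝ) =
          ((k + 2 * (4 * ρ + 1 + 1) + (ρ + ρ + 1) : ℕ) : ℝ) + ((k + 4 * (s + k) : ℕ) : ℝ) := by
          push_cast; ring
        linarith
      have h3 : ((3 * t * (k + 2 * (4 * ρ + 1 + 1) + (k + 4 * (s + k)) + (ρ + ρ + 1)) : ℕ) : ℝ) ≤
          δ / 8 * (m * s) := by
        rw [Nat.cast_mul]
        calc ((3 * t : ℕ) : ℝ) * _ ≤ ((3 * t : ℕ) : ℝ) * (6 * s) :=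
              mul_le_mul_of_nonneg_left h2 (Nat.cast_nonneg _)
          _ = (144 * t) * s / 8 := by push_cast; ring
          _ ≤ (δ * m) * s / 8 := by gcongr
          _ = δ / 8 * (m * s) := by ring
      rw [Nat.cast_add, Nat.cast_mul m s]
      linarith)
  refine hc.exists_wheel hdisj hH hδ hρ' ht hts ?_
  linarith

/-- For η ≤ 1, log(1 + η) ≥ η/(1 + η) ≥ η/2. -/
theorem lt_pow_of_log_lt {n η : ℝ} (hn : 0 < n) (hη : 0 < η) (hη1 : η ≤ 1) {ρ : ℕ}
    (h : Real.log n < ρ * (η / 2)) : n < (1 + η) ^ ρ := by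
  have h1 : η / 2 ≤ Real.log (1 + η) := by
    have := Real.one_sub_inv_le_log_of_pos (show 0 < 1 + η by linarith)
    refine le_trans ?_ this
    rw [div_le_iff₀ (by norm_num)]
    have h2 : (1 - (1 + η)⁻¹) * 2 = 2 * η / (1 + η) := by field_simp; ring
    rw [h2, le_div_iff₀ (by linarith)]
    nlinarith
  rw [← Real.log_lt_log_iff hn (by positivity), Real.log_pow]
  exact h.trans_le (mul_le_mul_of_nonneg_left h1 (Nat.cast_nonneg _))

/-- With L = log n, δ = ε₁/L² and ρ of order L³/ε₁, the quantity δ³n/ρ² is of order ε₁⁵n/L¹². As ε₁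
< 1 ≤ L, the required number of cycles is far below it. -/
theorem exists_large_wheel {V : Type u} [Fintype V] {H : SimpleGraph V} {ε₁ : ℝ} (hpos : 0 < ε₁)
    (hlt : ε₁ < 1) (hH : IsExpander H ε₁ 15) {n : ℕ} (hV : Fintype.card V = n) (hn : 32 ≤ n)
    (hL : 1 ≤ Real.log n) (hlarge : 10 ^ 14 * Real.log n ^ 12 ≤ ε₁ ^ 5 * n) :
    ∃ (ℓ : ℕ) (W : H.Subgraph), IsWheel W ℓ ∧
      (ε₁ / 20) ^ 16 * (2 * (n : ℝ) / Real.log n ^ 16) ≤ ℓ := by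
  subst hV
  set n : ℝ := (Fintype.card V : ℝ) with hn'
  set L := Real.log n with hLdef
  have hn0 : (32 : ℝ) ≤ n := by rw [hn']; exact_mod_cast hn
  set δ := ε₁ / L ^ 2 with hδdef
  have hL2 : (1 : ℝ) ≤ L ^ 2 := one_le_pow₀ hL
  have hL0 : 0 < L := by linarith
  have hδ : 0 < δ := by positivity
  have hδ1 : δ ≤ 1 := (div_le_one (by positivity)).2 (by linarith)
  set x := 200 * L ^ 3 / ε₁ with hx
  have hx0 : 200 ≤ x := by
    rw [hx, le_div_iff₀ hpos]
    have : (1 : ℝ) ≤ L ^ 3 := one_le_pow₀ hL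
    nlinarith
  set ρ : ℕ := ⌊x⌋₊ + 1 with hρdef
  have hρ1 : x < ρ := by rw [hρdef]; exact_mod_cast Nat.lt_floor_add_one x
  have hρ2 : (ρ : ℝ) ≤ 2 * x := by
    have := Nat.floor_le (show 0 ≤ x by linarith)
    rw [hρdef]; push_cast; linarith
  have hxδ : x * (δ / 100 / 2) = L := by
    rw [hx, hδdef]; field_simp; norm_num
  have hLρ : L < ρ * (δ / 100 / 2) :=
    hxδ.symm.trans_lt (mul_lt_mul_of_pos_right hρ1 (by positivity))
  set y := (ε₁ / 20) ^ 16 * (2 * n / L ^ 16) with hy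
  have hy0 : 0 ≤ y := by positivity
  -- The summand 2 guarantees the two cycles needed for closing; `z ≥ 10 ^ 14` absorbs it.
  set t : ℕ := ⌈y⌉₊ + 2 with ht
  have hyt : y ≤ t := by
    rw [ht]; push_cast
    have := Nat.le_ceil y
    linarith
  have hty : (t : ℝ) ≤ y + 3 := by
    rw [ht]; push_cast
    have := Nat.ceil_lt_add_one hy0
    linarith
  set z := ε₁ ^ 5 * n / L ^ 12 with hz
  have hz3 : 10 ^ 14 ≤ z := by
    rw [hz, le_div_iff₀ (by positivity)]; exact hlarge
  have hyz : y ≤ z / 10 ^ 20 := by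
    have h1 : ε₁ ^ 16 ≤ ε₁ ^ 5 := pow_le_pow_of_le_one hpos.le hlt.le (by norm_num)
    have h2 : L ^ 12 ≤ L ^ 16 := pow_le_pow_right₀ hL (by norm_num)
    calc y = (2 / 20 ^ 16) * (ε₁ ^ 16 * n / L ^ 16) := by rw [hy]; ring
      _ ≤ (1 / 10 ^ 20) * (ε₁ ^ 5 * n / L ^ 12) :=
        mul_le_mul (by norm_num) (by gcongr) (by positivity) (by positivity)
      _ = z / 10 ^ 20 := by rw [hz]; ring
  obtain ⟨W, hW⟩ := exists_wheel_of_parameters (hH.hasExpansion hpos) hδ hδ1 hn (ρ := ρ) (t := t)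
    (by omega) (lt_pow_of_log_lt (by linarith) (by positivity) (by linarith) hLρ) (by omega) (by
      have h1 : (ρ : ℝ) ^ 2 ≤ (2 * x) ^ 2 := pow_le_pow_left₀ (Nat.cast_nonneg _) hρ2 2
      have h2 : (t : ℝ) ≤ z / (16 * 10 ^ 12) := by linarith
      calc 10 ^ 8 * ((t : ℝ) * ρ ^ 2) ≤ 10 ^ 8 * (z / (16 * 10 ^ 12) * (2 * x) ^ 2) := by gcongr
        _ = δ ^ 3 * n := by rw [hz, hx, hδdef]; field_simp; norm_num)
  exact ⟨t, W, hW, hyt⟩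

theorem eventually_log_pow_le {ε₁ : ℝ} (hpos : 0 < ε₁) :
    ∃ n₀ : ℕ, ∀ n : ℕ, n₀ ≤ n → 32 ≤ n ∧ 1 ≤ Real.log n ∧
      10 ^ 14 * Real.log n ^ 12 ≤ ε₁ ^ 5 * n := by
  have h1 := (Real.isLittleO_pow_log_id_atTop (n := 12)).comp_tendsto
    (tendsto_natCast_atTop_atTop (R := ℝ))
  have h2 := h1.bound (show 0 < ε₁ ^ 5 / 10 ^ 14 by positivity)
  obtain ⟨N, hN⟩ := Filter.eventually_atTop.1 h2
  refine ⟨max N 32, fun n hn => ?_⟩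
  have hn32 : 32 ≤ n := (le_max_right _ _).trans hn
  have hn32' : (32 : ℝ) ≤ n := by exact_mod_cast hn32
  have h3 := hN n ((le_max_left _ _).trans hn)
  refine ⟨hn32, ?_, ?_⟩
  · rw [Real.le_log_iff_exp_le (by linarith)]
    have := Real.exp_one_lt_d9
    linarith
  · simp only [Function.comp, id, Real.norm_eq_abs] at h3
    rw [abs_of_nonneg (by positivity), abs_of_nonneg (by positivity)] at h3
    calc 10 ^ 14 * Real.log n ^ 12 ≤ 10 ^ 14 * (ε₁ ^ 5 / 10 ^ 14 * n) := by gcongr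
      _ = ε₁ ^ 5 * n := by ring

end Parameters
end SublinearExpander

theorem lemma2p7 (ε₁ : ℝ) (hpos : 0 < ε₁) (hlt : ε₁ < 1) :
    ∃ n₀ : ℕ, ∀ (n : ℕ), n₀ ≤ n →
      ∀ (V : Type*) [Fintype V] (H : SimpleGraph V), Fintype.card V = n →
        SublinearExpander.IsExpander H ε₁ 15 →
        ∃ (ℓ : ℕ) (W : H.Subgraph), SublinearExpander.IsWheel W ℓ ∧
          (ε₁ / 20) ^ 16 * (2 * (n : ℝ) / Real.log (n : ℝ) ^ 16) ≤ (ℓ : ℝ) := by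
  obtain ⟨n₀, hn₀⟩ := SublinearExpander.eventually_log_pow_le hpos
  refine ⟨n₀, fun n hn V _ H hV hH => ?_⟩
  obtain ⟨h1, h2, h3⟩ := hn₀ n hn
  exact SublinearExpander.exists_large_wheel hpos hlt hH hV h1 h2 h3
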